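/- Let $m,n\ge 0$ be integers. Let $X$ be a random vector in $\mathbb{R}^n$ with $\mathbb{E}\|X\|^2<\infty$, and let $N\sim\mathcal N(0,I_m)$ be independent of $X$. For $\Psi\in\mathbb{R}^{m\times n}$ put $Y_\Psi=\Psi X+N$ and let $I(X;Y_\Psi)$ be the mutual information in nats, i.e. the Kullback--Leibler divergence of the joint law of $(X,Y_\Psi)$ from the product of the marginal laws. For a Fréchet-differentiable $F:\mathbb{R}^n\to\mathbb{R}^{m\times n}$ put $$D_F(x,y)=F(x)-F(y)-DF(y)(x-y),$$ where $DF(y)$ is the Fréchet derivative of $F$ at $y$. Then $I(X;Y_\Psi)<\infty$ for every $\Psi\in\mathbb{R}^{m\times n}$. Moreover, for every $\Phi\in\mathbb{R}^{m\times n}$, with $Y=Y_\Phi$ and $F(x)=\Phi xx^T$: 1. $F$ is Fréchet differentiable; and if $\Phi$ has full column rank, there is a proper cone $K\subset\mathbb{R}^{m\times n}$ (closed, convex, pointed, with non-empty interior) such that $F$ is strictly $K$-convex, i.e. $\theta F(x)+(1-\theta)F(y)-F(\theta x+(1-\theta)y)\in\operatorname{int}K$ for all $x\ne y$ in $\mathbb{R}^n$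 and $\theta\in(0,1)$, so that $D_F$ is a generalized Bregman divergence. 2. The function $\Psi\mapsto I(X;Y_\Psi)$ is differentiable at $\Phi$, $D_F(X,\mathbb{E}[X\mid Y])$ is integrable, and the gradient (the matrix of partial derivatives with respect to the entries of the channel matrix) is $$\nabla_\Phi I(X;Y)=\mathbb{E}\big[D_F(X,\mathbb{E}[X\mid Y])\big].$$ 3. The matrix $(X-\mathbb{E}[X\mid Y])(X-\mathbb{E}[X\mid Y])^T$ is integrable, and $$\mathbb{E}\big[D_F(X,\mathbb{E}[X\mid Y])\big]=\Phi\,\mathbb{E}\big[(X-\mathbb{E}[X\mid Y])(X-\mathbb{E}[X\mid Y])^T\big].$$ -/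

import Mathlib

open MeasureTheory ProbabilityTheory
open scoped Matrix ENNReal

noncomputable section

/-- Proper cone in the space of `m × n` real matrices: a closed convex pointed cone with
non-empty interior. -/
structure IsProperMatrixCone {m n : ℕ} (K : Set (Matrix (Fin m) (Fin n) ℝ)) : Prop where
  smul_mem : ∀ c : ℝ, 0 ≤ c → ∀ A ∈ K, c • A ∈ K
  convex : Convex ℝ K
  isClosed : IsClosed K
  interior_nonempty : (interior K).Nonempty
  pointed : ∀ A, A ∈ K → -A ∈ K → A = 0

/-- Strict `K`-convexity on `S`:
`F (θ x + (1 - θ) y) ≺_K θ F x + (1 - θ) F y`, where `A ≺_K B` means `B - A ∈ int K`. -/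
def IsStrictlyKConvexOn {m n : ℕ} {W : Type*} [AddCommGroup W] [Module ℝ W]
    (K : Set (Matrix (Fin m) (Fin n) ℝ)) (S : Set W) (F : W → Matrix (Fin m) (Fin n) ℝ) : Prop :=
  ∀ x ∈ S, ∀ y ∈ S, x ≠ y → ∀ θ : ℝ, 0 < θ → θ < 1 →
    (θ • F x + (1 - θ) • F y) - F (θ • x + (1 - θ) • y) ∈ interior K

/-- `D_F(x, y) = F x - F y - DF(y)(x - y)`, with `DF(y)` the Fréchet derivative
(matrices carry the entrywise topology). -/
def generalizedBregman {m n : ℕ} {W : Type*} [NormedAddCommGroup W] [NormedSpace ℝ W]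
    (F : W → Matrix (Fin m) (Fin n) ℝ) (x y : W) : Matrix (Fin m) (Fin n) ℝ :=
  F x - F y - fderiv ℝ F y (x - y)

/-- Mutual information (in nats): the Kullback–Leibler divergence of the joint law from the
product of the marginal laws, with values in `[0, ∞]`. -/
def mutualInformation {Ω A B : Type*} [MeasurableSpace Ω] [MeasurableSpace A] [MeasurableSpace B]
    (μ : Measure Ω) (X : Ω → A) (Y : Ω → B) : ℝ≥0∞ :=
  InformationTheory.klDiv (μ.map (fun ω => (X ω, Y ω))) ((μ.map X).prod (μ.map Y))

/-- Output `Y = Φ X + N` of the vector channel. -/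
def channelOutput {Ω : Type*} {m n : ℕ} (Φ : Matrix (Fin m) (Fin n) ℝ)
    (X : Ω → EuclideanSpace ℝ (Fin n)) (N : Ω → EuclideanSpace ℝ (Fin m)) :
    Ω → EuclideanSpace ℝ (Fin m) :=
  fun ω => WithLp.toLp 2 (Φ *ᵥ (X ω).ofLp) + N ω

/-- Conditional mean `E[X | Y]`, as a random vector. -/
def conditionalMean {Ω : Type*} [MeasurableSpace Ω] {m n : ℕ} (μ : Measure Ω)
    (X : Ω → EuclideanSpace ℝ (Fin n)) (Y : Ω → EuclideanSpace ℝ (Fin m)) :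
    Ω → EuclideanSpace ℝ (Fin n) :=
  μ[X | MeasurableSpace.comap Y inferInstance]

/-- The matrix `x xᵀ`. -/
def outerSquare {n : ℕ} (x : EuclideanSpace ℝ (Fin n)) : Matrix (Fin n) (Fin n) ℝ :=
  Matrix.vecMulVec x.ofLp x.ofLp

/-- The function `F(x) = Φ x xᵀ`. -/
def gaussianLoss {m n : ℕ} (Φ : Matrix (Fin m) (Fin n) ℝ) (x : EuclideanSpace ℝ (Fin n)) :
    Matrix (Fin m) (Fin n) ℝ :=
  Φ * outerSquare x

/-- A random matrix is integrable when all its entries are. -/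
def MatrixIntegrable {Ω : Type*} [MeasurableSpace Ω] {m n : ℕ}
    (M : Ω → Matrix (Fin m) (Fin n) ℝ) (μ : Measure Ω) : Prop :=
  ∀ i j, Integrable (fun ω => M ω i j) μ

/-- Expectation of a random matrix (entrywise). -/
def matrixExpectation {Ω : Type*} [MeasurableSpace Ω] {m n : ℕ}
    (M : Ω → Matrix (Fin m) (Fin n) ℝ) (μ : Measure Ω) : Matrix (Fin m) (Fin n) ℝ :=
  Matrix.of fun i j => ∫ ω, M ω i j ∂μ

/-- The MMSE matrix `E[(X - E[X|Y]) (X - E[X|Y])ᵀ]`. -/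
def mmseMatrix {Ω : Type*} [MeasurableSpace Ω] {m n : ℕ} (μ : Measure Ω)
    (X : Ω → EuclideanSpace ℝ (Fin n)) (Y : Ω → EuclideanSpace ℝ (Fin m)) :
    Matrix (Fin n) (Fin n) ℝ :=
  matrixExpectation (fun ω => outerSquare (X ω - conditionalMean μ X Y ω)) μ

/-- `f` is (Fréchet) differentiable at `Φ` with gradient matrix `G`: its derivative is
`H ↦ ∑ i, ∑ j, G i j * H i j`. In particular `∂f/∂Φ i j = G i j`. -/
def HasMatrixGradientAt {m n : ℕ} (f : Matrix (Fin m) (Fin n) ℝ → ℝ)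
    (G Φ : Matrix (Fin m) (Fin n) ℝ) : Prop :=
  ∃ L : Matrix (Fin m) (Fin n) ℝ →L[ℝ] ℝ,
    (∀ H, L H = ∑ i, ∑ j, G i j * H i j) ∧ HasFDerivAt f L Φ

end

/-! With respect to the law of `N`, the output of a channel `A` has density `evidence`, L_A(y) = E
exp(⟪AX, y⟫ - ‖AX‖²/2), by Cameron–Martin. Hence I(A) = E‖AX‖²/2 - E log L_A(AX + N)
(`toReal_mutualInformation`), all terms being finite because log L_A grows at most quadratically.

Differentiability is obtained without differentiating under an integral. Gibbs' inequality bounds E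
log L_B(BX + N) from below by E log L_A(BX + N), and convexity of log L_A, with subgradient A E[X |
Y = y], compares the latter with E log L_A(AX + N). This gives I(B) - I(A) ≤ I'(A)(B - A) + O(‖B -
A‖²), with I'(A)H = E⟪A(X - E[X|Y]), HX⟫ (`toReal_mutualInformation_sub_le`). Exchanging A and B
gives a lower bound with I'(B), so continuity of I' suffices. It follows from L² continuity of the
Bayes estimate in the channel (`tendsto_integral_norm_bayesEstimate_sub_sq`), an application of
Vitali's theorem.

Orthogonality of the error to functions of Y turns I'(A)H into E⟪Ae, He⟫ with e = X - E[X|Y], which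
is the pairing of H with E[Φ e eᵀ]. Since F is quadratic, D_F(x, y) = F(x - y), so this matrix is
both the mean divergence and Φ times the MMSE matrix. Strict convexity comes from ⟨F(x), Φ⟩ = ‖Φx‖²,
which for injective Φ dominates ‖F(x)‖ and so keeps F(x) inside a cone around Φ. -/

set_option linter.unusedSectionVars false

/-! ### Translations of the standard Gaussian measure. -/

section CameronMartin

open scoped RealInnerProductSpace

variable {F : Type*} [NormedAddCommGroup F] [InnerProductSpace ℝ F] [FiniteDimensional ℝ F]
  [MeasurableSpace F] [BorelSpace F]

lemma integrable_exp_inner_stdGaussian (a : F) :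
    Integrable (fun y => Real.exp ⟪a, y⟫) (stdGaussian F) := by
  rw [stdGaussian, integrable_map_measure (by fun_prop) (Measurable.aemeasurable (by fun_prop))]
  have h : (fun y : F => Real.exp ⟪a, y⟫) ∘ (fun x : Fin (Module.finrank ℝ F) → ℝ =>
      ∑ i, x i • stdOrthonormalBasis ℝ F i)
      = fun x => ∏ i, Real.exp (⟪a, stdOrthonormalBasis ℝ F i⟫ * x i) := by
    ext x
    simp [inner_sum, inner_smul_right, Real.exp_sum, mul_comm]
  rw [h]
  exact Integrable.fintype_prod
    (f := fun i t => Real.exp (⟪a, stdOrthonormalBasis ℝ F i⟫ * t))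
    fun i => integrable_exp_mul_gaussianReal _

/-- In orthonormal coordinates the integral factors into one-dimensional Gaussian moment generating
functions at complex arguments. Up to normalization it is the characteristic function of the
Gaussian tilted by `a`. -/
lemma integral_cexp_inner_stdGaussian (a t : F) :
    ∫ y, Complex.exp (⟪y, a⟫ + ⟪y, t⟫ * Complex.I) ∂(stdGaussian F)
      = Complex.exp ((‖a‖ ^ 2 - ‖t‖ ^ 2) / 2 + ⟪a, t⟫ * Complex.I) := by
  set b := stdOrthonormalBasis ℝ F
  rw [stdGaussian, integral_map (Measurable.aemeasurable (by fun_prop))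
    (Measurable.aestronglyMeasurable (by fun_prop))]
  have h : (fun x : Fin (Module.finrank ℝ F) → ℝ => Complex.exp
      (⟪∑ i, x i • b i, a⟫ + ⟪∑ i, x i • b i, t⟫ * Complex.I))
      = fun x => ∏ i, Complex.exp ((⟪b i, a⟫ + ⟪b i, t⟫ * Complex.I) * x i) := by
    ext x
    rw [← Complex.exp_sum]
    congr 1
    simp only [sum_inner, real_inner_smul_left, Complex.ofReal_sum, Complex.ofReal_mul,
      Finset.sum_mul, ← Finset.sum_add_distrib]
    exact Finset.sum_congr rfl fun i _ => by ring
  have h1 : ∀ i, ∫ s : ℝ, Complex.exp ((⟪b i, a⟫ + ⟪b i, t⟫ * Complex.I) * s) ∂(gaussianReal 0 1)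
      = Complex.exp ((⟪b i, a⟫ + ⟪b i, t⟫ * Complex.I) ^ 2 / 2) := by
    intro i
    simpa [complexMGF] using complexMGF_id_gaussianReal (μ := 0) (v := 1)
      (⟪b i, a⟫ + ⟪b i, t⟫ * Complex.I : ℂ)
  change ∫ x : Fin (Module.finrank ℝ F) → ℝ, Complex.exp
      (⟪∑ i, x i • b i, a⟫ + ⟪∑ i, x i • b i, t⟫ * Complex.I) ∂_ = _
  rw [h, integral_fintype_prod_eq_prod
    (f := fun i (s : ℝ) => Complex.exp ((⟪b i, a⟫ + ⟪b i, t⟫ * Complex.I) * s))]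
  simp_rw [h1]
  rw [← Complex.exp_sum]
  congr 1
  have ha : (‖a‖ ^ 2 : ℂ) = ∑ i, (⟪b i, a⟫ : ℂ) ^ 2 := by
    rw [← Complex.ofReal_pow, ← b.sum_sq_norm_inner_right a]
    simp
  have ht : (‖t‖ ^ 2 : ℂ) = ∑ i, (⟪b i, t⟫ : ℂ) ^ 2 := by
    rw [← Complex.ofReal_pow, ← b.sum_sq_norm_inner_right t]
    simp
  have hat : (⟪a, t⟫ : ℂ) = ∑ i, (⟪b i, a⟫ : ℂ) * ⟪b i, t⟫ := by
    rw [← b.sum_inner_mul_inner a t]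
    simp [real_inner_comm]
  rw [ha, ht, hat, ← Finset.sum_sub_distrib, Finset.sum_div, Finset.sum_mul,
    ← Finset.sum_add_distrib]
  refine Finset.sum_congr rfl fun i _ => ?_
  linear_combination (⟪b i, t⟫ : ℂ) ^ 2 / 2 * Complex.I_sq

/-- Cameron–Martin formula for the standard Gaussian measure in finite dimension. -/
lemma stdGaussian_map_const_add (a : F) :
    (stdGaussian F).map (fun y => a + y) = (stdGaussian F).withDensity
      (fun y => ENNReal.ofReal (Real.exp (⟪a, y⟫ - ‖a‖ ^ 2 / 2))) := by
  have hint : Integrable (fun y => Real.exp (⟪a, y⟫ - ‖a‖ ^ 2 / 2)) (stdGaussian F) := by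
    simp_rw [Real.exp_sub]
    exact (integrable_exp_inner_stdGaussian a).div_const _
  have : IsFiniteMeasure ((stdGaussian F).withDensity
      (fun y => ENNReal.ofReal (Real.exp (⟪a, y⟫ - ‖a‖ ^ 2 / 2)))) :=
    isFiniteMeasure_withDensity_ofReal hint.2
  have : IsFiniteMeasure ((stdGaussian F).map (fun y => a + y)) := by
    infer_instance
  -- Both measures are finite, so equality of characteristic functions is enough.
  apply Measure.ext_of_charFun
  ext t
  rw [charFun_map_const_add, charFun_stdGaussian, charFun_apply,
    integral_withDensity_eq_integral_toReal_smul (by fun_prop) (by simp)]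
  have h : (fun y : F => (ENNReal.ofReal (Real.exp (⟪a, y⟫ - ‖a‖ ^ 2 / 2))).toReal •
      Complex.exp (⟪y, t⟫ * Complex.I)) = fun y => Complex.exp (-(‖a‖ ^ 2 / 2 : ℝ)) *
      Complex.exp (⟪y, a⟫ + ⟪y, t⟫ * Complex.I) := by
    ext y
    rw [ENNReal.toReal_ofReal (Real.exp_pos _).le, Complex.real_smul, Complex.ofReal_exp,
      ← Complex.exp_add, ← Complex.exp_add, real_inner_comm a y]
    congr 1
    push_cast
    ring
  rw [h, integral_const_mul, integral_cexp_inner_stdGaussian, ← Complex.exp_add,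
    ← Complex.exp_add]
  congr 1
  push_cast
  ring

end CameronMartin

/-! ### Channel densities, evidence and its logarithm. -/

section Channel

open scoped RealInnerProductSpace

variable {E F : Type*} [NormedAddCommGroup E] [InnerProductSpace ℝ E] [FiniteDimensional ℝ E]
  [MeasurableSpace E] [BorelSpace E] [NormedAddCommGroup F] [InnerProductSpace ℝ F]
  [FiniteDimensional ℝ F] [MeasurableSpace F] [BorelSpace F]

/-- Density of `A x + N` with respect to the law of the standard Gaussian vector `N`. -/
noncomputable def channelDensity (A : E →L[ℝ] F) (x : E) (y : F) : ℝ :=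
  Real.exp (⟪A x, y⟫ - ‖A x‖ ^ 2 / 2)

/-- Density of the output `A X + N` with respect to the law of the standard Gaussian vector `N`,
when `X` has law `P`. -/
noncomputable def evidence (P : Measure E) (A : E →L[ℝ] F) (y : F) : ℝ :=
  ∫ x, channelDensity A x y ∂P

/-- Mean of the input given the output `y`, by Bayes' formula. -/
noncomputable def posteriorMean (P : Measure E) (A : E →L[ℝ] F) (y : F) : E :=
  (evidence P A y)⁻¹ • ∫ x, channelDensity A x y • x ∂P

lemma channelDensity_pos (A : E →L[ℝ] F) (x : E) (y : F) : 0 < channelDensity A x y :=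
  Real.exp_pos _

/-- Completing the square. The bound depends on neither `A` nor `x`, so it serves as the dominating
function throughout. -/
lemma channelDensity_le (A : E →L[ℝ] F) (x : E) (y : F) :
    channelDensity A x y ≤ Real.exp (‖y‖ ^ 2 / 2) := by
  refine Real.exp_le_exp.2 ?_
  nlinarith [real_inner_le_norm (A x) y, sq_nonneg (‖A x‖ - ‖y‖)]

lemma continuous_channelDensity :
    Continuous fun p : (E →L[ℝ] F) × E × F => channelDensity p.1 p.2.1 p.2.2 := by
  unfold channelDensity
  fun_prop

@[fun_prop]
lemma measurable_channelDensity (A : E →L[ℝ] F) :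
    Measurable fun p : E × F => channelDensity A p.1 p.2 :=
  (continuous_channelDensity.comp (Continuous.prodMk_right A)).measurable

lemma channelDensity_add (A : E →L[ℝ] F) (x : E) (y v : F) :
    channelDensity A x (y + v) = channelDensity A x y * Real.exp ⟪v, A x⟫ := by
  rw [channelDensity, channelDensity, ← Real.exp_add, inner_add_right, real_inner_comm v]
  congr 1
  ring

variable (P : Measure E) [IsProbabilityMeasure P]

lemma integrable_channelDensity_smul {G : Type*} [NormedAddCommGroup G] [NormedSpace ℝ G]
    (A : E →L[ℝ] F) (y : F) {f : E → G} (hf : Integrable f P) :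
    Integrable (fun x => channelDensity A x y • f x) P := by
  refine hf.bdd_smul (Real.exp (‖y‖ ^ 2 / 2)) ?_ ?_
  · exact ((measurable_channelDensity A).comp measurable_prodMk_right).aestronglyMeasurable
  · refine Filter.Eventually.of_forall fun x => ?_
    rw [Real.norm_of_nonneg (channelDensity_pos A x y).le]
    exact channelDensity_le A x y

lemma integrable_channelDensity (A : E →L[ℝ] F) (y : F) :
    Integrable (fun x => channelDensity A x y) P := by
  simpa using integrable_channelDensity_smul P A y (integrable_const (1 : ℝ))

lemma evidence_pos (A : E →L[ℝ] F) (y : F) : 0 < evidence P A y :=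
  integral_exp_pos (integrable_channelDensity P A y)

lemma evidence_le (A : E →L[ℝ] F) (y : F) : evidence P A y ≤ Real.exp (‖y‖ ^ 2 / 2) := by
  have := integral_mono (integrable_channelDensity P A y) (integrable_const _)
    (fun x => channelDensity_le A x y)
  rwa [integral_const, probReal_univ, one_smul] at this

@[fun_prop]
lemma measurable_evidence (A : E →L[ℝ] F) : Measurable (evidence P A) :=
  ((measurable_channelDensity A).comp measurable_swap).stronglyMeasurable.integral_prod_right'.measurable

@[fun_prop]
lemma measurable_posteriorMean (A : E →L[ℝ] F) : Measurable (posteriorMean P A) := by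
  refine (measurable_evidence P A).inv.smul ?_
  refine (StronglyMeasurable.integral_prod_right'
    (f := fun p : F × E => channelDensity A p.2 p.1 • p.2) ?_).measurable
  exact Measurable.stronglyMeasurable
    (((measurable_channelDensity A).comp measurable_swap).smul measurable_snd)

lemma evidence_smul_posteriorMean (A : E →L[ℝ] F) (y : F) :
    evidence P A y • posteriorMean P A y = ∫ x, channelDensity A x y • x ∂P := by
  rw [posteriorMean, smul_inv_smul₀ (evidence_pos P A y).ne']

variable {P}

lemma MeasureTheory.MemLp.integrable_norm_sq_clm {G : Type*} [NormedAddCommGroup G] [NormedSpace ℝ G]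
    {H : Type*} [NormedAddCommGroup H] [NormedSpace ℝ H]
    {Ω : Type*} [MeasurableSpace Ω] {μ : Measure Ω} {X : Ω → G} (hX : MemLp X 2 μ)
    (A : G →L[ℝ] H) : Integrable (fun ω => ‖A (X ω)‖ ^ 2) μ :=
  (A.comp_memLp' hX).integrable_norm_pow two_ne_zero

/-- The upper bound is pointwise; the lower one is Jensen's inequality for `exp`. Quadratic growth
makes the log-evidence integrable under any output law with a second moment. -/
lemma abs_log_evidence_le (hP : MemLp id 2 P) (A : E →L[ℝ] F) (y : F) :
    |Real.log (evidence P A y)| ≤ ‖y‖ ^ 2 / 2 + ∫ x, ‖A x‖ ^ 2 ∂P := by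
  have hA : Integrable (fun x => ‖A x‖ ^ 2) P := hP.integrable_norm_sq_clm A
  have hi : Integrable (fun x => ⟪A x, y⟫) P := by
    have h1 : Integrable (fun x : E => A x) P := A.integrable_comp (hP.integrable (by norm_num))
    exact h1.inner_const y
  have hA0 : 0 ≤ ∫ x, ‖A x‖ ^ 2 ∂P := integral_nonneg fun x => sq_nonneg _
  rw [abs_le]
  constructor
  · rw [Real.le_log_iff_exp_le (evidence_pos P A y)]
    have hJ : Real.exp (∫ x, (⟪A x, y⟫ - ‖A x‖ ^ 2 / 2) ∂P) ≤ evidence P A y :=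
      convexOn_exp.map_integral_le Real.continuous_exp.continuousOn isClosed_univ (by simp)
        (hi.sub (hA.div_const 2)) (integrable_channelDensity P A y)
    refine (Real.exp_le_exp.2 ?_).trans hJ
    have h2 : -(‖y‖ ^ 2 / 2 + ∫ x, ‖A x‖ ^ 2 ∂P) = ∫ x, (-(‖y‖ ^ 2 / 2) - ‖A x‖ ^ 2) ∂P := by
      rw [integral_sub (integrable_const _) hA]
      simp
      ring
    rw [h2]
    refine integral_mono ((integrable_const _).sub hA) (hi.sub (hA.div_const 2)) fun x => ?_
    have := neg_le_of_abs_le (abs_real_inner_le_norm (A x) y)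
    change -(‖y‖ ^ 2 / 2) - ‖A x‖ ^ 2 ≤ ⟪A x, y⟫ - ‖A x‖ ^ 2 / 2
    nlinarith [sq_nonneg (‖A x‖ - ‖y‖)]
  · have := (Real.log_le_iff_le_exp (evidence_pos P A y)).2 (evidence_le P A y)
    linarith

/-- The logarithm of the evidence is convex, with `A (posteriorMean P A y)` as a subgradient. -/
lemma log_evidence_add_ge (hP : Integrable id P) (A : E →L[ℝ] F) (y v : F) :
    Real.log (evidence P A y) + ⟪v, A (posteriorMean P A y)⟫
      ≤ Real.log (evidence P A (y + v)) := by
  set a := ⟪v, A (posteriorMean P A y)⟫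
  have hL := evidence_pos P A y
  rw [Real.le_log_iff_exp_le (evidence_pos P A _), Real.exp_add, Real.exp_log hL]
  have hk := integrable_channelDensity P A y
  have hkx := integrable_channelDensity_smul P A y hP
  have hkv : Integrable (fun x => channelDensity A x y * ⟪v, A x⟫) P := by
    have := integrable_channelDensity_smul P A y
      (((innerSL ℝ v).comp A).integrable_comp hP)
    simpa using this
  have hmean : ∫ x, channelDensity A x y * ⟪v, A x⟫ ∂P = evidence P A y * a := by
    have h := ((innerSL ℝ v).comp A).integral_comp_comm hkx
    simp only [id, ← evidence_smul_posteriorMean] at h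
    simpa [a, inner_smul_right] using h
  -- Jensen under the posterior: integrate the tangent inequality exp s ≥ exp a · (1 + s - a) at s =
  -- ⟪v, A x⟫. As `a` is the posterior mean of s, the first-order term cancels.
  have hle : ∫ x, (Real.exp a * (channelDensity A x y * (1 - a) + channelDensity A x y * ⟪v, A x⟫)) ∂P
      ≤ evidence P A (y + v) := by
    refine integral_mono (((hk.mul_const _).add hkv).const_mul _)
      (integrable_channelDensity P A _) fun x => ?_
    change Real.exp a * (channelDensity A x y * (1 - a) + channelDensity A x y * ⟪v, A x⟫)
      ≤ channelDensity A x (y + v)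
    rw [channelDensity_add]
    have h1 : Real.exp ⟪v, A x⟫ = Real.exp a * Real.exp (⟪v, A x⟫ - a) := by
      rw [← Real.exp_add]; congr 1; ring
    have h2 := Real.add_one_le_exp (⟪v, A x⟫ - a)
    rw [h1]
    have h3 := mul_pos (Real.exp_pos a) (channelDensity_pos A x y)
    nlinarith
  rw [integral_const_mul, integral_add (hk.mul_const _) hkv, hmean, integral_mul_const] at hle
  change Real.exp a * (evidence P A y * (1 - a) + evidence P A y * a) ≤ _ at hle
  linarith

end Channel

/-! ### Joint and output laws, and a formula for the mutual information. -/

section Information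

open scoped RealInnerProductSpace

variable {E F : Type*} [NormedAddCommGroup E] [InnerProductSpace ℝ E] [FiniteDimensional ℝ E]
  [MeasurableSpace E] [BorelSpace E] [NormedAddCommGroup F] [InnerProductSpace ℝ F]
  [FiniteDimensional ℝ F] [MeasurableSpace F] [BorelSpace F]
  {Ω : Type*} [MeasurableSpace Ω]

lemma MeasureTheory.MemLp.integrable_real_inner {μ : Measure Ω} {f g : Ω → E}
    (hf : MemLp f 2 μ) (hg : MemLp g 2 μ) : Integrable (fun ω => ⟪f ω, g ω⟫) μ :=
  (hf.norm.integrable_mul hg.norm).mono' (hf.1.inner hg.1)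
    (Filter.Eventually.of_forall fun ω => norm_inner_le_norm (f ω) (g ω))

/-- A square-integrable input and an independent standard Gaussian noise. -/
structure IsGaussianChannel (μ : Measure Ω) (X : Ω → E) (N : Ω → F) : Prop where
  measurable_input : Measurable X
  measurable_noise : Measurable N
  memLp_input : MemLp X 2 μ
  map_noise : μ.map N = stdGaussian F
  indepFun : IndepFun X N μ

namespace IsGaussianChannel

variable {μ : Measure Ω} [IsProbabilityMeasure μ] {X : Ω → E} {N : Ω → F}

lemma memLp_noise (h : IsGaussianChannel μ X N) : MemLp N 2 μ := by
  have h2 : MemLp id 2 (μ.map N) := by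
    rw [h.map_noise]
    exact IsGaussian.memLp_two_id
  exact (memLp_map_measure_iff (by fun_prop) h.measurable_noise.aemeasurable).1 h2

lemma isProbabilityMeasure_map_input (h : IsGaussianChannel μ X N) :
    IsProbabilityMeasure (μ.map X) :=
  Measure.isProbabilityMeasure_map h.measurable_input.aemeasurable

lemma memLp_id_map_input (h : IsGaussianChannel μ X N) : MemLp id 2 (μ.map X) :=
  (memLp_map_measure_iff (by fun_prop) h.measurable_input.aemeasurable).2 h.memLp_input

lemma integrable_id_map_input (h : IsGaussianChannel μ X N) : Integrable id (μ.map X) := by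
  have := h.isProbabilityMeasure_map_input
  exact h.memLp_id_map_input.integrable (by norm_num)

lemma measurable_output (h : IsGaussianChannel μ X N) (A : E →L[ℝ] F) :
    Measurable fun ω => A (X ω) + N ω :=
  (A.continuous.measurable.comp h.measurable_input).add h.measurable_noise

lemma memLp_output (h : IsGaussianChannel μ X N) (A : E →L[ℝ] F) :
    MemLp (fun ω => A (X ω) + N ω) 2 μ :=
  (A.comp_memLp' h.memLp_input).add h.memLp_noise

lemma map_input_noise (h : IsGaussianChannel μ X N) :
    μ.map (fun ω => (X ω, N ω)) = (μ.map X).prod (stdGaussian F) := by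
  rw [(indepFun_iff_map_prod_eq_prod_map_map h.measurable_input.aemeasurable
    h.measurable_noise.aemeasurable).1 h.indepFun, h.map_noise]

/-- For fixed input `x` the output is the noise translated by `A x`; apply Cameron–Martin on each
fibre. -/
lemma map_input_output (h : IsGaussianChannel μ X N) (A : E →L[ℝ] F) :
    μ.map (fun ω => (X ω, A (X ω) + N ω)) = ((μ.map X).prod (stdGaussian F)).withDensity
      (fun p => ENNReal.ofReal (channelDensity A p.1 p.2)) := by
  have := h.isProbabilityMeasure_map_input
  have hk : Measurable fun p : E × F => ENNReal.ofReal (channelDensity A p.1 p.2) := by fun_prop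
  have hT : Measurable fun p : E × F => (p.1, A p.1 + p.2) := by fun_prop
  have hXN : Measurable fun ω => (X ω, N ω) := h.measurable_input.prodMk h.measurable_noise
  have h1 : μ.map (fun ω => (X ω, A (X ω) + N ω))
      = ((μ.map X).prod (stdGaussian F)).map (fun p => (p.1, A p.1 + p.2)) := by
    rw [← h.map_input_noise, Measure.map_map hT hXN]
    rfl
  rw [h1]
  refine Measure.ext_of_lintegral _ fun f hf => ?_
  rw [lintegral_map hf hT, lintegral_prod (fun p => f (p.1, A p.1 + p.2)) (hf.comp hT).aemeasurable,
    lintegral_withDensity_eq_lintegral_mul _ hk hf, lintegral_prod _ (hk.mul hf).aemeasurable]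
  refine lintegral_congr fun x => ?_
  have hfx : Measurable fun y => f (x, y) := hf.comp measurable_prodMk_left
  have h2 : ∫⁻ w, f (x, A x + w) ∂(stdGaussian F)
      = ∫⁻ y, f (x, y) ∂((stdGaussian F).map fun w => A x + w) :=
    (lintegral_map hfx (by fun_prop)).symm
  change ∫⁻ w, f (x, A x + w) ∂(stdGaussian F) = _
  rw [h2, stdGaussian_map_const_add,
    lintegral_withDensity_eq_lintegral_mul _ (by fun_prop) hfx]
  rfl

lemma map_output (h : IsGaussianChannel μ X N) (A : E →L[ℝ] F) :
    μ.map (fun ω => A (X ω) + N ω) = (stdGaussian F).withDensity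
      (fun y => ENNReal.ofReal (evidence (μ.map X) A y)) := by
  have := h.isProbabilityMeasure_map_input
  have hk : Measurable fun p : E × F => ENNReal.ofReal (channelDensity A p.1 p.2) := by fun_prop
  have h1 : μ.map (fun ω => A (X ω) + N ω)
      = (μ.map (fun ω => (X ω, A (X ω) + N ω))).map Prod.snd := by
    rw [Measure.map_map measurable_snd (h.measurable_input.prodMk (h.measurable_output A))]
    rfl
  rw [h1, h.map_input_output]
  refine Measure.ext_of_lintegral _ fun f hf => ?_
  have hf2 : Measurable fun p : E × F => f p.2 := hf.comp measurable_snd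
  rw [lintegral_map hf measurable_snd, lintegral_withDensity_eq_lintegral_mul _ hk hf2,
    lintegral_prod_symm _ (hk.mul hf2).aemeasurable,
    lintegral_withDensity_eq_lintegral_mul _ (by fun_prop) hf]
  refine lintegral_congr fun y => ?_
  simp only [Pi.mul_apply]
  have hky : Measurable fun x => ENNReal.ofReal (channelDensity A x y) :=
    hk.comp measurable_prodMk_right
  rw [lintegral_mul_const _ hky, evidence,
    ofReal_integral_eq_lintegral_ofReal (integrable_channelDensity _ A y)
      (Filter.Eventually.of_forall fun x => (channelDensity_pos A x y).le)]

lemma integrable_evidence (h : IsGaussianChannel μ X N) (A : E →L[ℝ] F) :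
    Integrable (evidence (μ.map X) A) (stdGaussian F) := by
  have := h.isProbabilityMeasure_map_input
  refine ⟨(measurable_evidence _ A).aestronglyMeasurable, ?_⟩
  rw [hasFiniteIntegral_iff_ofReal
    (Filter.Eventually.of_forall fun y => (evidence_pos (μ.map X) A y).le),
    ← setLIntegral_univ, ← withDensity_apply _ MeasurableSet.univ, ← h.map_output A]
  exact measure_lt_top _ _

lemma integral_evidence (h : IsGaussianChannel μ X N) (A : E →L[ℝ] F) :
    ∫ y, evidence (μ.map X) A y ∂(stdGaussian F) = 1 := by
  have := h.isProbabilityMeasure_map_input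
  rw [integral_eq_lintegral_of_nonneg_ae
    (Filter.Eventually.of_forall fun y => (evidence_pos (μ.map X) A y).le)
    (measurable_evidence _ A).aestronglyMeasurable,
    ← setLIntegral_univ, ← withDensity_apply _ MeasurableSet.univ, ← h.map_output A,
    Measure.map_apply (h.measurable_output A) MeasurableSet.univ]
  simp

/-- Integrals of functions of the output. -/
lemma integral_comp_output (h : IsGaussianChannel μ X N) (A : E →L[ℝ] F) {G : Type*}
    [NormedAddCommGroup G] [NormedSpace ℝ G] {f : F → G} (hf : StronglyMeasurable f) :
    ∫ ω, f (A (X ω) + N ω) ∂μ = ∫ y, evidence (μ.map X) A y • f y ∂(stdGaussian F) := by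
  have := h.isProbabilityMeasure_map_input
  rw [← integral_map (f := f) (h.measurable_output A).aemeasurable hf.aestronglyMeasurable,
    h.map_output, integral_withDensity_eq_integral_toReal_smul (by fun_prop) (by simp)]
  refine integral_congr_ae (Filter.Eventually.of_forall fun y => ?_)
  simp only [ENNReal.toReal_ofReal (evidence_pos (μ.map X) A y).le]

lemma integrable_comp_output_iff (h : IsGaussianChannel μ X N) (A : E →L[ℝ] F) {G : Type*}
    [NormedAddCommGroup G] [NormedSpace ℝ G] {f : F → G} (hf : StronglyMeasurable f) :
    Integrable (fun ω => f (A (X ω) + N ω)) μ ↔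
      Integrable (fun y => evidence (μ.map X) A y • f y) (stdGaussian F) := by
  have := h.isProbabilityMeasure_map_input
  change Integrable (f ∘ fun ω => A (X ω) + N ω) μ ↔ _
  rw [← integrable_map_measure hf.aestronglyMeasurable (h.measurable_output A).aemeasurable,
    h.map_output, integrable_withDensity_iff_integrable_smul' (by fun_prop) (by simp)]
  refine integrable_congr (Filter.Eventually.of_forall fun y => ?_)
  simp only [ENNReal.toReal_ofReal (evidence_pos (μ.map X) A y).le]

/-- Two channels are needed because Gibbs' inequality evaluates the evidence of one at the output of
the other. -/
lemma integrable_log_evidence (h : IsGaussianChannel μ X N) (A B : E →L[ℝ] F) :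
    Integrable (fun ω => Real.log (evidence (μ.map X) A (B (X ω) + N ω))) μ := by
  have := h.isProbabilityMeasure_map_input
  have hY := (h.memLp_output B).integrable_norm_pow two_ne_zero
  refine ((hY.div_const 2).add (integrable_const (∫ x, ‖A x‖ ^ 2 ∂(μ.map X)))).mono' ?_ ?_
  · exact ((measurable_evidence _ A).log.comp (h.measurable_output B)).aestronglyMeasurable
  · exact Filter.Eventually.of_forall fun ω => abs_log_evidence_le h.memLp_id_map_input A _

/-- Gibbs' inequality for the output densities of two channels. -/
lemma integral_log_evidence_le (h : IsGaussianChannel μ X N) (A B : E →L[ℝ] F) :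
    ∫ ω, Real.log (evidence (μ.map X) A (B (X ω) + N ω)) ∂μ
      ≤ ∫ ω, Real.log (evidence (μ.map X) B (B (X ω) + N ω)) ∂μ := by
  have := h.isProbabilityMeasure_map_input
  set LA := evidence (μ.map X) A
  set LB := evidence (μ.map X) B
  have hq : StronglyMeasurable fun y => LA y / LB y :=
    ((measurable_evidence _ A).div (measurable_evidence _ B)).stronglyMeasurable
  have heq : (fun y => LB y • (LA y / LB y)) = LA := by
    ext y
    rw [smul_eq_mul, mul_div_cancel₀ _ (evidence_pos _ B y).ne']
  -- The quotient is the density of one output law against the other, so it has mean one; Gibbs'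
  -- inequality is then log q ≤ q - 1.
  have hqi : Integrable (fun ω => LA (B (X ω) + N ω) / LB (B (X ω) + N ω)) μ := by
    rw [h.integrable_comp_output_iff B hq, heq]
    exact h.integrable_evidence A
  have hq1 : ∫ ω, LA (B (X ω) + N ω) / LB (B (X ω) + N ω) ∂μ = 1 := by
    rw [h.integral_comp_output B hq, heq]
    exact h.integral_evidence A
  have hle : ∫ ω, Real.log (LA (B (X ω) + N ω)) ∂μ ≤ ∫ ω, (Real.log (LB (B (X ω) + N ω)) +
      (LA (B (X ω) + N ω) / LB (B (X ω) + N ω) - 1)) ∂μ := by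
    refine integral_mono (h.integrable_log_evidence A B)
      ((h.integrable_log_evidence B B).add (hqi.sub (integrable_const _))) fun ω => ?_
    have hA := evidence_pos (μ.map X) A (B (X ω) + N ω)
    have hB := evidence_pos (μ.map X) B (B (X ω) + N ω)
    have := Real.log_le_sub_one_of_pos (div_pos hA hB)
    rw [Real.log_div hA.ne' hB.ne'] at this
    change Real.log (LA _) ≤ Real.log (LB _) + _
    linarith
  have := integral_add (h.integrable_log_evidence B B) (hqi.sub (integrable_const 1))
  simp only [Pi.sub_apply] at this
  rw [this, integral_sub hqi (integrable_const _), hq1] at hle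
  simpa using hle

lemma integrable_inner_noise (h : IsGaussianChannel μ X N) (A : E →L[ℝ] F) :
    Integrable (fun ω => ⟪A (X ω), N ω⟫) μ :=
  MemLp.integrable_real_inner (A.comp_memLp' h.memLp_input) h.memLp_noise

lemma integral_inner_noise (h : IsGaussianChannel μ X N) (A : E →L[ℝ] F) :
    ∫ ω, ⟪A (X ω), N ω⟫ ∂μ = 0 := by
  have := h.isProbabilityMeasure_map_input
  have hXN : Measurable fun ω => (X ω, N ω) := h.measurable_input.prodMk h.measurable_noise
  have hf : AEStronglyMeasurable (fun p : E × F => ⟪A p.1, p.2⟫) (μ.map fun ω => (X ω, N ω)) :=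
    Continuous.aestronglyMeasurable (by fun_prop)
  have h1 := integral_map hXN.aemeasurable hf
  have h2 := (integrable_map_measure hf hXN.aemeasurable).2 (h.integrable_inner_noise A)
  rw [h.map_input_noise] at h1 h2
  rw [← h1, integral_prod _ h2]
  have h3 : ∀ x, ∫ y, ⟪A x, y⟫ ∂(stdGaussian F) = 0 := by
    intro x
    have := integral_inner (𝕜 := ℝ) (μ := stdGaussian F) (f := fun y => y)
      (IsGaussian.integrable_id) (A x)
    rw [this, integral_id_stdGaussian, inner_zero_right]
  simp [h3]

lemma integrable_log_channelDensity (h : IsGaussianChannel μ X N) (A : E →L[ℝ] F) :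
    Integrable (fun ω => ⟪A (X ω), A (X ω) + N ω⟫ - ‖A (X ω)‖ ^ 2 / 2) μ :=
  (MemLp.integrable_real_inner (A.comp_memLp' h.memLp_input) (h.memLp_output A)).sub
    ((h.memLp_input.integrable_norm_sq_clm A).div_const 2)

/-- Joint and product laws both have densities against (law of `X`) ⊗ Gaussian, namely
`channelDensity` and `evidence`. The latter is positive, so the likelihood ratio is their quotient.
-/
lemma absolutelyContinuous_and_llr (h : IsGaussianChannel μ X N) (A : E →L[ℝ] F) :
    μ.map (fun ω => (X ω, A (X ω) + N ω)) ≪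
        (μ.map X).prod (μ.map fun ω => A (X ω) + N ω) ∧
      llr (μ.map (fun ω => (X ω, A (X ω) + N ω)))
          ((μ.map X).prod (μ.map fun ω => A (X ω) + N ω))
        =ᵐ[μ.map (fun ω => (X ω, A (X ω) + N ω))] fun p =>
          ⟪A p.1, p.2⟫ - ‖A p.1‖ ^ 2 / 2 - Real.log (evidence (μ.map X) A p.2) := by
  have := h.isProbabilityMeasure_map_input
  have := Measure.isProbabilityMeasure_map (μ := μ) (h.measurable_output A).aemeasurable
  set Q := (μ.map X).prod (μ.map fun ω => A (X ω) + N ω) with hQdef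
  have hr : Measurable fun p : E × F =>
      ENNReal.ofReal (channelDensity A p.1 p.2 / evidence (μ.map X) A p.2) := by fun_prop
  have hL : Measurable fun p : E × F => ENNReal.ofReal (evidence (μ.map X) A p.2) := by fun_prop
  have hQ : Q = ((μ.map X).prod (stdGaussian F)).withDensity
      (fun p => ENNReal.ofReal (evidence (μ.map X) A p.2)) := by
    rw [hQdef, h.map_output A, prod_withDensity_right (by fun_prop)]
  have hJ : μ.map (fun ω => (X ω, A (X ω) + N ω)) = Q.withDensity (fun p =>
      ENNReal.ofReal (channelDensity A p.1 p.2 / evidence (μ.map X) A p.2)) := by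
    rw [hQ, ← withDensity_mul _ hL hr, h.map_input_output]
    congr 1
    ext p
    have hp := evidence_pos (μ.map X) A p.2
    rw [Pi.mul_apply, ← ENNReal.ofReal_mul hp.le, mul_div_cancel₀ _ hp.ne']
  have hac : μ.map (fun ω => (X ω, A (X ω) + N ω)) ≪ Q := by
    rw [hJ]
    exact withDensity_absolutelyContinuous _ _
  refine ⟨hac, ?_⟩
  have hd := Measure.rnDeriv_withDensity Q hr
  rw [← hJ] at hd
  filter_upwards [hac.ae_le hd] with p hp
  have hk := channelDensity_pos A p.1 p.2
  have hp0 := evidence_pos (μ.map X) A p.2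
  rw [llr, hp, ENNReal.toReal_ofReal (div_pos hk hp0).le, Real.log_div hk.ne' hp0.ne',
    channelDensity, Real.log_exp]

lemma integrable_llr (h : IsGaussianChannel μ X N) (A : E →L[ℝ] F) :
    Integrable (llr (μ.map (fun ω => (X ω, A (X ω) + N ω)))
      ((μ.map X).prod (μ.map fun ω => A (X ω) + N ω)))
      (μ.map (fun ω => (X ω, A (X ω) + N ω))) := by
  have := h.isProbabilityMeasure_map_input
  rw [integrable_congr (h.absolutelyContinuous_and_llr A).2,
    integrable_map_measure (Measurable.aestronglyMeasurable (by fun_prop))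
      (h.measurable_input.prodMk (h.measurable_output A)).aemeasurable]
  exact (h.integrable_log_channelDensity A).sub (h.integrable_log_evidence A A)

lemma mutualInformation_ne_top (h : IsGaussianChannel μ X N) (A : E →L[ℝ] F) :
    mutualInformation μ X (fun ω => A (X ω) + N ω) ≠ ∞ :=
  InformationTheory.klDiv_ne_top (h.absolutelyContinuous_and_llr A).1 (h.integrable_llr A)

/-- In the mean log-likelihood ratio, the cross term ⟪AX, N⟫ has mean zero because the noise is
centred and independent of the input. -/
lemma toReal_mutualInformation (h : IsGaussianChannel μ X N) (A : E →L[ℝ] F) :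
    (mutualInformation μ X (fun ω => A (X ω) + N ω)).toReal
      = (∫ ω, ‖A (X ω)‖ ^ 2 ∂μ) / 2
        - ∫ ω, Real.log (evidence (μ.map X) A (A (X ω) + N ω)) ∂μ := by
  have := h.isProbabilityMeasure_map_input
  have hXY := h.measurable_input.prodMk (h.measurable_output A)
  have := Measure.isProbabilityMeasure_map (μ := μ) (h.measurable_output A).aemeasurable
  have := Measure.isProbabilityMeasure_map (μ := μ) hXY.aemeasurable
  rw [mutualInformation, InformationTheory.toReal_klDiv_of_measure_eq
    (h.absolutelyContinuous_and_llr A).1 (by simp),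
    integral_congr_ae (h.absolutelyContinuous_and_llr A).2,
    integral_map hXY.aemeasurable (Measurable.aestronglyMeasurable (by fun_prop)),
    integral_sub (h.integrable_log_channelDensity A) (h.integrable_log_evidence A A)]
  congr 1
  have hsq := h.memLp_input.integrable_norm_sq_clm A
  have h1 : (fun ω => ⟪A (X ω), A (X ω) + N ω⟫ - ‖A (X ω)‖ ^ 2 / 2)
      = fun ω => ‖A (X ω)‖ ^ 2 / 2 + ⟪A (X ω), N ω⟫ := by
    ext ω
    rw [inner_add_right, real_inner_self_eq_norm_sq]
    ring
  simp only [h1]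
  rw [integral_add (hsq.div_const 2) (h.integrable_inner_noise A), h.integral_inner_noise,
    add_zero, integral_div]

end IsGaussianChannel

end Information

/-! ### The Bayes estimate and its continuity in the channel. -/

section Estimation

open scoped RealInnerProductSpace Topology
open Filter

variable {E F : Type*} [NormedAddCommGroup E] [InnerProductSpace ℝ E] [FiniteDimensional ℝ E]
  [MeasurableSpace E] [BorelSpace E] [NormedAddCommGroup F] [InnerProductSpace ℝ F]
  [FiniteDimensional ℝ F] [MeasurableSpace F] [BorelSpace F]
  {Ω : Type*} [MeasurableSpace Ω]

/-- Dominated convergence: the bound on the density is uniform in the channel, so only `y` has to be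
kept bounded. -/
lemma continuous_integral_channelDensity_smul (P : Measure E) {G : Type*} [NormedAddCommGroup G]
    [NormedSpace ℝ G] {f : E → G} (hf : Integrable f P) :
    Continuous fun p : (E →L[ℝ] F) × F => ∫ x, channelDensity p.1 x p.2 • f x ∂P := by
  rw [continuous_iff_continuousAt]
  intro p
  refine continuousAt_of_dominated
    (bound := fun x => Real.exp ((‖p.2‖ + 1) ^ 2 / 2) * ‖f x‖) ?_ ?_ (hf.norm.const_mul _) ?_
  · refine Eventually.of_forall fun q => ?_
    exact ((measurable_channelDensity q.1).comp
      measurable_prodMk_right).aestronglyMeasurable.smul hf.1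
  · have h1 : ∀ᶠ q : (E →L[ℝ] F) × F in 𝓝 p, ‖q.2‖ < ‖p.2‖ + 1 :=
      (continuous_snd.norm.continuousAt (x := p)).eventually_lt_const (lt_add_one _)
    filter_upwards [h1] with q hq
    refine Eventually.of_forall fun x => ?_
    rw [norm_smul, Real.norm_of_nonneg (channelDensity_pos _ _ _).le]
    refine mul_le_mul_of_nonneg_right ((channelDensity_le q.1 x q.2).trans ?_) (norm_nonneg _)
    gcongr
  · refine Eventually.of_forall fun x => ?_
    refine Continuous.continuousAt ?_
    exact (continuous_channelDensity.comp
      (f := fun q : (E →L[ℝ] F) × F => (q.1, x, q.2)) (by fun_prop)).smul continuous_const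

lemma continuous_posteriorMean (P : Measure E) [IsProbabilityMeasure P] (hP : Integrable id P) :
    Continuous fun p : (E →L[ℝ] F) × F => posteriorMean P p.1 p.2 := by
  have h1 : Continuous fun p : (E →L[ℝ] F) × F => evidence P p.1 p.2 := by
    simpa [evidence] using
      continuous_integral_channelDensity_smul (F := F) P (integrable_const (1 : ℝ))
  exact (h1.inv₀ fun p => (evidence_pos P p.1 p.2).ne').smul
    (continuous_integral_channelDensity_smul P hP)

/-- The estimate of the input of the channel `A` from its output, by Bayes' formula. -/
noncomputable def bayesEstimate (μ : Measure Ω) (X : Ω → E) (N : Ω → F) (A : E →L[ℝ] F) : Ω → E :=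
  fun ω => posteriorMean (μ.map X) A (A (X ω) + N ω)

namespace IsGaussianChannel

variable {μ : Measure Ω} [IsProbabilityMeasure μ] {X : Ω → E} {N : Ω → F}

lemma integrable_input (h : IsGaussianChannel μ X N) : Integrable X μ :=
  h.memLp_input.integrable (by norm_num)

lemma integrable_channelDensity_smul_fst (h : IsGaussianChannel μ X N) (A : E →L[ℝ] F) :
    Integrable (fun p : E × F => channelDensity A p.1 p.2 • p.1)
      ((μ.map X).prod (stdGaussian F)) := by
  have := h.isProbabilityMeasure_map_input
  have h1 : Integrable (fun p : E × F => p.1) (μ.map fun ω => (X ω, A (X ω) + N ω)) := by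
    rw [integrable_map_measure (Measurable.aestronglyMeasurable (by fun_prop))
      (h.measurable_input.prodMk (h.measurable_output A)).aemeasurable]
    exact h.integrable_input
  rw [h.map_input_output, integrable_withDensity_iff_integrable_smul' (by fun_prop) (by simp)] at h1
  refine (integrable_congr (Eventually.of_forall fun p => ?_)).1 h1
  simp only [ENNReal.toReal_ofReal (channelDensity_pos A p.1 p.2).le]

lemma measurable_bayesEstimate (h : IsGaussianChannel μ X N) (A : E →L[ℝ] F) :
    Measurable (bayesEstimate μ X N A) := by
  have := h.isProbabilityMeasure_map_input
  exact (measurable_posteriorMean _ A).comp (h.measurable_output A)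

lemma integrable_bayesEstimate (h : IsGaussianChannel μ X N) (A : E →L[ℝ] F) :
    Integrable (bayesEstimate μ X N A) μ := by
  have := h.isProbabilityMeasure_map_input
  refine (h.integrable_comp_output_iff A (measurable_posteriorMean _ A).stronglyMeasurable).2 ?_
  simp_rw [evidence_smul_posteriorMean]
  exact (h.integrable_channelDensity_smul_fst A).integral_prod_right

/-- The output density cancels the normalization of the posterior mean, so both sides become the
same double integral of `channelDensity A x y • x`, up to Fubini. -/
lemma setIntegral_bayesEstimate (h : IsGaussianChannel μ X N) (A : E →L[ℝ] F) {B : Set F}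
    (hB : MeasurableSet B) :
    ∫ ω in (fun ω => A (X ω) + N ω) ⁻¹' B, bayesEstimate μ X N A ω ∂μ
      = ∫ ω in (fun ω => A (X ω) + N ω) ⁻¹' B, X ω ∂μ := by
  have := h.isProbabilityMeasure_map_input
  have hXY := h.measurable_input.prodMk (h.measurable_output A)
  have hB2 : MeasurableSet (Prod.snd ⁻¹' B : Set (E × F)) := measurable_snd hB
  have hY := h.measurable_output A hB
  have hpm := (measurable_posteriorMean (μ.map X) A).stronglyMeasurable
  have hl : ∫ ω in (fun ω => A (X ω) + N ω) ⁻¹' B, bayesEstimate μ X N A ω ∂μ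
      = ∫ y in B, ∫ x, channelDensity A x y • x ∂(μ.map X) ∂(stdGaussian F) := by
    have h1 := h.integral_comp_output A (hpm.indicator hB)
    rw [← integral_indicator hY, ← integral_indicator hB]
    refine Eq.trans ?_ (h1.trans ?_)
    · rfl
    · refine integral_congr_ae (Eventually.of_forall fun y => ?_)
      by_cases hy : y ∈ B
      · simp [hy, evidence_smul_posteriorMean]
      · simp [hy]
  have hr : ∫ ω in (fun ω => A (X ω) + N ω) ⁻¹' B, X ω ∂μ
      = ∫ p in (Prod.snd ⁻¹' B : Set (E × F)), p.1 ∂(μ.map fun ω => (X ω, A (X ω) + N ω)) :=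
    (setIntegral_map (f := fun p : E × F => p.1) hB2 continuous_fst.aestronglyMeasurable hXY.aemeasurable).symm
  have hk : Measurable fun p : E × F => ENNReal.ofReal (channelDensity A p.1 p.2) := by fun_prop
  rw [hl, hr, h.map_input_output, restrict_withDensity hB2,
    integral_withDensity_eq_integral_toReal_smul hk (by simp)]
  simp_rw [ENNReal.toReal_ofReal (channelDensity_pos A _ _).le]
  have hset : (Prod.snd ⁻¹' B : Set (E × F)) = Set.univ ×ˢ B := by ext; simp
  rw [hset, ← Measure.prod_restrict, Measure.restrict_univ, integral_prod_symm]
  have := (h.integrable_channelDensity_smul_fst A).restrict (s := Set.univ ×ˢ B)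
  rwa [← Measure.prod_restrict, Measure.restrict_univ] at this

/-- The Bayes estimate is the conditional mean of the input given the output. -/
lemma bayesEstimate_ae_eq_condExp (h : IsGaussianChannel μ X N) (A : E →L[ℝ] F) :
    bayesEstimate μ X N A =ᵐ[μ]
      μ[X | MeasurableSpace.comap (fun ω => A (X ω) + N ω) inferInstance] := by
  have := h.isProbabilityMeasure_map_input
  refine ae_eq_condExp_of_forall_setIntegral_eq (h.measurable_output A).comap_le
    h.integrable_input (fun s _ _ => (h.integrable_bayesEstimate A).integrableOn) ?_ ?_
  · rintro s ⟨B, hB, rfl⟩ -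
    exact h.setIntegral_bayesEstimate A hB
  · exact ((measurable_posteriorMean (μ.map X) A).comp
      (comap_measurable _)).stronglyMeasurable.aestronglyMeasurable

lemma memLp_bayesEstimate (h : IsGaussianChannel μ X N) (A : E →L[ℝ] F) :
    MemLp (bayesEstimate μ X N A) 2 μ :=
  (memLp_congr_ae (h.bayesEstimate_ae_eq_condExp A)).2 (h.memLp_input.condExp (by norm_num))

/-- Conditional Jensen. The right-hand sides, as `A` varies, are conditional expectations of one
integrable variable, hence uniformly integrable. -/
lemma norm_bayesEstimate_sq_le (h : IsGaussianChannel μ X N) (A : E →L[ℝ] F) :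
    (fun ω => ‖bayesEstimate μ X N A ω‖ ^ 2) ≤ᵐ[μ]
      μ[fun ω => ‖X ω‖ ^ 2 | MeasurableSpace.comap (fun ω => A (X ω) + N ω) inferInstance] := by
  have h1 := Integrable.norm_condExp_rpow_le (f := X) (μ := μ) (p := 2)
    (m := MeasurableSpace.comap (fun ω => A (X ω) + N ω) inferInstance) (by norm_num)
    (by simpa using h.memLp_input.integrable_norm_pow two_ne_zero)
  simp only [Real.rpow_two] at h1
  filter_upwards [h1, h.bayesEstimate_ae_eq_condExp A] with ω h2 h3
  rwa [h3]

/-- Vitali's theorem along sequences of channels: pointwise convergence plus uniform integrability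
of the squared differences. -/
lemma tendsto_integral_norm_bayesEstimate_sub_sq (h : IsGaussianChannel μ X N)
    (A : E →L[ℝ] F) :
    Tendsto (fun B => ∫ ω, ‖bayesEstimate μ X N B ω - bayesEstimate μ X N A ω‖ ^ 2 ∂μ)
      (𝓝 A) (𝓝 0) := by
  have := h.isProbabilityMeasure_map_input
  refine tendsto_of_seq_tendsto fun u hu => ?_
  set D : ℕ → Ω → ℝ :=
    fun k ω => ‖bayesEstimate μ X N (u k) ω - bayesEstimate μ X N A ω‖ ^ 2 with hD
  have hDm : ∀ k, AEStronglyMeasurable (D k) μ := fun k =>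
    (((h.measurable_bayesEstimate (u k)).sub
      (h.measurable_bayesEstimate A)).norm.pow_const 2).aestronglyMeasurable
  set V : (E →L[ℝ] F) → Ω → ℝ := fun B => μ[fun ω => ‖X ω‖ ^ 2 |
    MeasurableSpace.comap (fun ω => B (X ω) + N ω) inferInstance] with hV
  have hVi : ∀ B, MemLp (V B) 1 μ := fun B => memLp_one_iff_integrable.2 integrable_condExp
  -- The doubled sum is the bound in ‖b - a‖² ≤ 2‖b‖² + 2‖a‖².
  have hU : UnifIntegrable (fun k => V (u k) + V A + (V (u k) + V A)) 1 μ := by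
    have h1 : UnifIntegrable (fun k => V (u k)) 1 μ :=
      ((h.memLp_input.integrable_norm_pow two_ne_zero).uniformIntegrable_condExp
        fun k => (h.measurable_output (u k)).comap_le).unifIntegrable
    have h2 : UnifIntegrable (fun _ : ℕ => V A) 1 μ :=
      unifIntegrable_const le_rfl (by simp) (hVi A)
    have h3 := h1.add h2 le_rfl (fun k => (hVi _).1) (fun k => (hVi _).1)
    exact h3.add h3 le_rfl (fun k => ((hVi _).1.add (hVi _).1))
      (fun k => ((hVi _).1.add (hVi _).1))
  have hDU : UnifIntegrable D 1 μ := by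
    intro ε hε
    obtain ⟨δ, hδ, H⟩ := hU hε
    refine ⟨δ, hδ, fun k s hs hμs => (eLpNorm_mono_ae ?_).trans (H k s hs hμs)⟩
    filter_upwards [h.norm_bayesEstimate_sq_le (u k), h.norm_bayesEstimate_sq_le A] with ω h1 h2
    by_cases hω : ω ∈ s
    · simp only [Set.indicator_of_mem hω, Pi.add_apply]
      have h3 := norm_sub_le (bayesEstimate μ X N (u k) ω) (bayesEstimate μ X N A ω)
      have h4 : D k ω ≤ V (u k) ω + V A ω + (V (u k) ω + V A ω) := by
        have h5 : D k ω ≤ (‖bayesEstimate μ X N (u k) ω‖ + ‖bayesEstimate μ X N A ω‖) ^ 2 :=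
          pow_le_pow_left₀ (norm_nonneg _) h3 2
        change _ ≤ V (u k) ω at h1
        change _ ≤ V A ω at h2
        nlinarith [sq_nonneg (‖bayesEstimate μ X N (u k) ω‖ - ‖bayesEstimate μ X N A ω‖)]
      rw [Real.norm_of_nonneg (sq_nonneg _)]
      exact h4.trans (le_abs_self _)
    · simp [Set.indicator_of_notMem hω]
  have hlim : ∀ᵐ ω ∂μ, Tendsto (fun k => D k ω) atTop (𝓝 ((0 : Ω → ℝ) ω)) := by
    refine Eventually.of_forall fun ω => ?_
    -- Joint continuity is required: changing the channel moves both the posterior and the output.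
    have hc : Continuous fun B : E →L[ℝ] F => bayesEstimate μ X N B ω :=
      (continuous_posteriorMean (μ.map X) h.integrable_id_map_input).comp
        (f := fun B : E →L[ℝ] F => (B, B (X ω) + N ω)) (by fun_prop)
    have h1 := (((hc.sub (continuous_const (y := bayesEstimate μ X N A ω))).norm.pow 2).tendsto
      A).comp hu
    simpa [Function.comp_def, D] using h1
  have hT := tendsto_Lp_finite_of_tendsto_ae le_rfl (by simp) hDm (MemLp.zero (p := 1)) hDU hlim
  have hT2 := (ENNReal.tendsto_toReal ENNReal.zero_ne_top).comp hT
  refine hT2.congr fun k => ?_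
  rw [Function.comp_apply, sub_zero, eLpNorm_one_eq_lintegral_enorm,
    ← integral_norm_eq_lintegral_enorm (hDm k)]
  refine integral_congr_ae (Eventually.of_forall fun ω => ?_)
  exact Real.norm_of_nonneg (sq_nonneg _)

end IsGaussianChannel

end Estimation

/-! ### Derivative of the mutual information in the channel. -/

section Gradient

open scoped RealInnerProductSpace Topology
open Filter

variable {E F : Type*} [NormedAddCommGroup E] [InnerProductSpace ℝ E] [FiniteDimensional ℝ E]
  [MeasurableSpace E] [BorelSpace E] [NormedAddCommGroup F] [InnerProductSpace ℝ F]
  [FiniteDimensional ℝ F] [MeasurableSpace F] [BorelSpace F]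
  {Ω : Type*} [MeasurableSpace Ω]

lemma MeasureTheory.MemLp.integral_norm_mul_norm_le {G H : Type*} [NormedAddCommGroup G]
    [NormedAddCommGroup H] {μ : Measure Ω} {f : Ω → G} {g : Ω → H}
    (hf : MemLp f 2 μ) (hg : MemLp g 2 μ) :
    ∫ ω, ‖f ω‖ * ‖g ω‖ ∂μ ≤ √(∫ ω, ‖f ω‖ ^ 2 ∂μ) * √(∫ ω, ‖g ω‖ ^ 2 ∂μ) := by
  have h := integral_mul_norm_le_Lp_mul_Lq (μ := μ) (f := fun ω => ‖f ω‖) (g := fun ω => ‖g ω‖)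
    Real.HolderConjugate.two_two (by simpa using hf.norm) (by simpa using hg.norm)
  simpa [Real.sqrt_eq_rpow] using h

/-- The error has zero conditional expectation, and `m`-measurable factors can be pulled out. -/
lemma integral_inner_sub_condExp {Ω' : Type*} {m m₀ : MeasurableSpace Ω'} {μ : Measure Ω'}
    [IsFiniteMeasure μ] (hm : m ≤ m₀) {X : Ω' → E} (hX : MemLp X 2 μ) (A H : E →L[ℝ] F) :
    ∫ ω, ⟪A (X ω - (μ[X | m]) ω), H ((μ[X | m]) ω)⟫ ∂μ = 0 := by
  have hXi := hX.integrable (by norm_num)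
  have hc := hX.condExp (m := m) (by norm_num)
  have hHc : MemLp (fun ω => H ((μ[X | m]) ω)) 2 μ := H.comp_memLp' hc
  have hAe : MemLp (fun ω => A (X ω - (μ[X | m]) ω)) 2 μ := A.comp_memLp' (hX.sub hc)
  have hsm : StronglyMeasurable[m] fun ω => H ((μ[X | m]) ω) :=
    H.continuous.comp_stronglyMeasurable stronglyMeasurable_condExp
  let T : F →L[ℝ] E →L[ℝ] ℝ := (ContinuousLinearMap.compL ℝ E F ℝ).flip A ∘L innerSL ℝ
  have hT : ∀ y x, T y x = ⟪y, A x⟫ := fun y x => rfl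
  have hint : Integrable (fun ω => T (H ((μ[X | m]) ω)) (X ω - (μ[X | m]) ω)) μ :=
    hHc.integrable_real_inner hAe
  have hpull := condExp_bilin_of_stronglyMeasurable_left T hsm hint
    (hXi.sub integrable_condExp)
  have hz : μ[X - μ[X | m] | m] =ᵐ[μ] 0 := by
    have h1 := condExp_sub hXi (integrable_condExp (m := m) (f := X) (μ := μ)) m
    rw [condExp_of_stronglyMeasurable hm stronglyMeasurable_condExp integrable_condExp] at h1
    filter_upwards [h1] with ω h2
    rw [h2, Pi.sub_apply, sub_self, Pi.zero_apply]
  have h2 : ∫ ω, T (H ((μ[X | m]) ω)) (X ω - (μ[X | m]) ω) ∂μ = 0 := by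
    rw [← integral_condExp hm, integral_congr_ae (hpull.trans ?_), integral_zero]
    filter_upwards [hz] with ω hω
    change T _ ((μ[X - μ[X | m] | m]) ω) = 0
    rw [hω, Pi.zero_apply, map_zero]
  simpa only [hT, real_inner_comm] using h2

namespace IsGaussianChannel

variable {μ : Measure Ω} [IsProbabilityMeasure μ] {X : Ω → E} {N : Ω → F}

lemma memLp_error (h : IsGaussianChannel μ X N) (A : E →L[ℝ] F) :
    MemLp (fun ω => X ω - bayesEstimate μ X N A ω) 2 μ :=
  h.memLp_input.sub (h.memLp_bayesEstimate A)

lemma memLp_clm_error (h : IsGaussianChannel μ X N) (A B : E →L[ℝ] F) :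
    MemLp (fun ω => B (X ω - bayesEstimate μ X N A ω)) 2 μ :=
  B.comp_memLp' (h.memLp_error A)

lemma memLp_clm_input (h : IsGaussianChannel μ X N) (A : E →L[ℝ] F) :
    MemLp (fun ω => A (X ω)) 2 μ :=
  A.comp_memLp' h.memLp_input

lemma integrable_inner_error_input (h : IsGaussianChannel μ X N) (A B H : E →L[ℝ] F) :
    Integrable (fun ω => ⟪B (X ω - bayesEstimate μ X N A ω), H (X ω)⟫) μ :=
  (h.memLp_clm_error A B).integrable_real_inner (h.memLp_clm_input H)

/-- The derivative of the mutual information with respect to the channel. -/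
noncomputable def informationDerivative (h : IsGaussianChannel μ X N) (A : E →L[ℝ] F) :
    (E →L[ℝ] F) →L[ℝ] ℝ :=
  LinearMap.toContinuousLinearMap
    { toFun := fun H => ∫ ω, ⟪A (X ω - bayesEstimate μ X N A ω), H (X ω)⟫ ∂μ
      map_add' := fun H H' => by
        simp only [_root_.add_apply, inner_add_right]
        exact integral_add (h.integrable_inner_error_input A A H)
          (h.integrable_inner_error_input A A H')
      map_smul' := fun c H => by
        simp only [_root_.smul_apply, inner_smul_right, RingHom.id_apply,
          smul_eq_mul]
        exact integral_const_mul _ _ }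

lemma informationDerivative_apply (h : IsGaussianChannel μ X N) (A H : E →L[ℝ] F) :
    h.informationDerivative A H = ∫ ω, ⟪A (X ω - bayesEstimate μ X N A ω), H (X ω)⟫ ∂μ :=
  rfl

/-- Gibbs puts the evidence of `A` at the output of `B`, which is the output of `A` shifted by (B -
A)X; the subgradient inequality handles the shift. The quadratic remainder comes from E‖BX‖²/2. -/
lemma toReal_mutualInformation_sub_le (h : IsGaussianChannel μ X N) (A B : E →L[ℝ] F) :
    (mutualInformation μ X (fun ω => B (X ω) + N ω)).toReal
        - (mutualInformation μ X (fun ω => A (X ω) + N ω)).toReal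
      ≤ h.informationDerivative A (B - A) + ‖B - A‖ ^ 2 * (∫ ω, ‖X ω‖ ^ 2 ∂μ) / 2 := by
  have := h.isProbabilityMeasure_map_input
  rw [h.toReal_mutualInformation, h.toReal_mutualInformation, informationDerivative_apply]
  have hG := h.integral_log_evidence_le A B
  have hi : Integrable (fun ω => ⟪(B - A) (X ω), A (bayesEstimate μ X N A ω)⟫) μ :=
    (h.memLp_clm_input (B - A)).integrable_real_inner (A.comp_memLp' (h.memLp_bayesEstimate A))
  have hsub : ∫ ω, (Real.log (evidence (μ.map X) A (A (X ω) + N ω)) +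
      ⟪(B - A) (X ω), A (bayesEstimate μ X N A ω)⟫) ∂μ
      ≤ ∫ ω, Real.log (evidence (μ.map X) A (B (X ω) + N ω)) ∂μ := by
    refine integral_mono ((h.integrable_log_evidence A A).add hi)
      (h.integrable_log_evidence A B) fun ω => ?_
    have h1 := log_evidence_add_ge h.integrable_id_map_input A (A (X ω) + N ω) ((B - A) (X ω))
    have h2 : A (X ω) + N ω + (B - A) (X ω) = B (X ω) + N ω := by
      rw [_root_.sub_apply]
      abel
    rwa [h2] at h1
  rw [integral_add (h.integrable_log_evidence A A) hi] at hsub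
  have hA := h.memLp_input.integrable_norm_sq_clm A
  have hB := h.memLp_input.integrable_norm_sq_clm B
  have hH := h.memLp_input.integrable_norm_sq_clm (B - A)
  have hg := h.integrable_inner_error_input A A (B - A)
  have hexp : (∫ ω, ‖B (X ω)‖ ^ 2 ∂μ) / 2 - (∫ ω, ‖A (X ω)‖ ^ 2 ∂μ) / 2
      - ∫ ω, ⟪(B - A) (X ω), A (bayesEstimate μ X N A ω)⟫ ∂μ
      = (∫ ω, ⟪A (X ω - bayesEstimate μ X N A ω), (B - A) (X ω)⟫ ∂μ)
        + (∫ ω, ‖(B - A) (X ω)‖ ^ 2 ∂μ) / 2 := by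
    rw [← integral_div, ← integral_div, ← integral_div,
      ← integral_sub (hB.div_const 2) (hA.div_const 2),
      ← integral_sub (f := fun ω => ‖B (X ω)‖ ^ 2 / 2 - ‖A (X ω)‖ ^ 2 / 2)
        ((hB.div_const 2).sub (hA.div_const 2)) hi,
      ← integral_add hg (hH.div_const 2)]
    refine integral_congr_ae (Eventually.of_forall fun ω => ?_)
    have h1 : B (X ω) = A (X ω) + (B - A) (X ω) := by simp
    have h2 := norm_add_sq_real (A (X ω)) ((B - A) (X ω))
    rw [← h1] at h2
    simp only [map_sub, inner_sub_left] at h2 ⊢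
    rw [h2, real_inner_comm (A (bayesEstimate μ X N A ω))]
    ring
  have hbound : ∫ ω, ‖(B - A) (X ω)‖ ^ 2 ∂μ ≤ ‖B - A‖ ^ 2 * ∫ ω, ‖X ω‖ ^ 2 ∂μ := by
    rw [← integral_const_mul]
    refine integral_mono hH
      ((h.memLp_input.integrable_norm_pow two_ne_zero).const_mul _) fun ω => ?_
    change ‖(B - A) (X ω)‖ ^ 2 ≤ ‖B - A‖ ^ 2 * ‖X ω‖ ^ 2
    rw [← mul_pow]
    exact pow_le_pow_left₀ (norm_nonneg _) ((B - A).le_opNorm _) 2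
  linarith

lemma integral_norm_sub_error_sq_le (h : IsGaussianChannel μ X N) (A B : E →L[ℝ] F) :
    ∫ ω, ‖B (X ω - bayesEstimate μ X N B ω) - A (X ω - bayesEstimate μ X N A ω)‖ ^ 2 ∂μ
      ≤ 4 * ‖B - A‖ ^ 2 * (∫ ω, ‖X ω - bayesEstimate μ X N A ω‖ ^ 2 ∂μ)
        + (4 * ‖B - A‖ ^ 2 + 2 * ‖A‖ ^ 2) *
          ∫ ω, ‖bayesEstimate μ X N B ω - bayesEstimate μ X N A ω‖ ^ 2 ∂μ := by
  have hS := (h.memLp_error A).integrable_norm_pow two_ne_zero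
  have hD := ((h.memLp_bayesEstimate B).sub (h.memLp_bayesEstimate A)).integrable_norm_pow
    two_ne_zero
  simp only [Pi.sub_apply] at hD
  rw [← integral_const_mul, ← integral_const_mul,
    ← integral_add (hS.const_mul _) (hD.const_mul _)]
  refine integral_mono (((h.memLp_clm_error B B).sub
    (h.memLp_clm_error A A)).integrable_norm_pow two_ne_zero)
    ((hS.const_mul _).add (hD.const_mul _)) fun ω => ?_
  set x := X ω
  set a := bayesEstimate μ X N A ω
  set b := bayesEstimate μ X N B ω
  change ‖B (x - b) - A (x - a)‖ ^ 2
    ≤ 4 * ‖B - A‖ ^ 2 * ‖x - a‖ ^ 2 + (4 * ‖B - A‖ ^ 2 + 2 * ‖A‖ ^ 2) * ‖b - a‖ ^ 2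
  -- Only the error of `A` and the change of estimate appear; two uses of (p + q)² ≤ 2p² + 2q² then
  -- give the constants 4 and 2.
  have h1 : B (x - b) - A (x - a) = (B - A) ((x - a) - (b - a)) - A (b - a) := by
    simp only [map_sub, _root_.sub_apply]
    abel
  have h2 : ‖B (x - b) - A (x - a)‖ ≤ ‖B - A‖ * (‖x - a‖ + ‖b - a‖) + ‖A‖ * ‖b - a‖ := by
    rw [h1]
    refine (norm_sub_le _ _).trans (add_le_add (((B - A).le_opNorm _).trans ?_) (A.le_opNorm _))
    exact mul_le_mul_of_nonneg_left (norm_sub_le _ _) (norm_nonneg _)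
  refine (pow_le_pow_left₀ (norm_nonneg _) h2 2).trans ?_
  nlinarith [sq_nonneg (‖B - A‖ * (‖x - a‖ + ‖b - a‖) - ‖A‖ * ‖b - a‖),
    sq_nonneg (‖B - A‖ * (‖x - a‖ - ‖b - a‖))]

/-- Cauchy–Schwarz; with the preceding bound this yields continuity of the derivative. -/
lemma abs_informationDerivative_sub_le (h : IsGaussianChannel μ X N) (A B H : E →L[ℝ] F) :
    |h.informationDerivative B H - h.informationDerivative A H|
      ≤ √(∫ ω, ‖B (X ω - bayesEstimate μ X N B ω) - A (X ω - bayesEstimate μ X N A ω)‖ ^ 2 ∂μ)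
        * √(∫ ω, ‖X ω‖ ^ 2 ∂μ) * ‖H‖ := by
  have hΔ : MemLp (fun ω => B (X ω - bayesEstimate μ X N B ω)
      - A (X ω - bayesEstimate μ X N A ω)) 2 μ :=
    (h.memLp_clm_error B B).sub (h.memLp_clm_error A A)
  rw [informationDerivative_apply, informationDerivative_apply,
    ← integral_sub (h.integrable_inner_error_input B B H) (h.integrable_inner_error_input A A H)]
  refine le_trans ?_ (mul_le_mul_of_nonneg_right (hΔ.integral_norm_mul_norm_le h.memLp_input)
    (norm_nonneg H))
  rw [← integral_mul_const, ← Real.norm_eq_abs]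
  refine norm_integral_le_of_norm_le
    ((hΔ.norm.integrable_mul h.memLp_input.norm).mul_const _) (Eventually.of_forall fun ω => ?_)
  rw [← inner_sub_left, mul_assoc, mul_comm ‖X ω‖]
  exact (norm_inner_le_norm _ _).trans
    (mul_le_mul_of_nonneg_left (H.le_opNorm _) (norm_nonneg _))

/-- The mutual information is differentiable with respect to the channel. -/
lemma hasFDerivAt_mutualInformation (h : IsGaussianChannel μ X N) (A : E →L[ℝ] F) :
    HasFDerivAt (fun B : E →L[ℝ] F => (mutualInformation μ X (fun ω => B (X ω) + N ω)).toReal)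
      (h.informationDerivative A) A := by
  set C := ∫ ω, ‖X ω‖ ^ 2 ∂μ with hC
  have hC0 : 0 ≤ C := integral_nonneg fun ω => sq_nonneg _
  set S := ∫ ω, ‖X ω - bayesEstimate μ X N A ω‖ ^ 2 ∂μ
  set D : (E →L[ℝ] F) → ℝ :=
    fun B => ∫ ω, ‖bayesEstimate μ X N B ω - bayesEstimate μ X N A ω‖ ^ 2 ∂μ
  set r : (E →L[ℝ] F) → ℝ := fun B => ‖B - A‖ * C / 2 +
    √(4 * ‖B - A‖ ^ 2 * S + (4 * ‖B - A‖ ^ 2 + 2 * ‖A‖ ^ 2) * D B) * √C with hr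
  have hr0 : Tendsto r (𝓝 A) (𝓝 0) := by
    have hD : Tendsto D (𝓝 A) (𝓝 0) := h.tendsto_integral_norm_bayesEstimate_sub_sq A
    have hn : Tendsto (fun B : E →L[ℝ] F => ‖B - A‖) (𝓝 A) (𝓝 0) :=
      tendsto_norm_sub_self A
    have h1 := ((((hn.pow 2).const_mul 4).mul_const S).add
      ((((hn.pow 2).const_mul 4).add_const (2 * ‖A‖ ^ 2)).mul hD)).sqrt.mul_const (√C)
    have h2 := ((hn.mul_const C).div_const 2).add h1
    simpa using h2
  rw [hasFDerivAt_iff_isLittleO, Asymptotics.isLittleO_iff]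
  intro c hc
  filter_upwards [hr0.eventually_lt_const hc] with B hB
  refine le_trans ?_ (mul_le_mul_of_nonneg_right hB.le (norm_nonneg (B - A)))
  have h1 := h.toReal_mutualInformation_sub_le A B
  -- Exchanging the channels gives the lower estimate, with the derivative taken at `B`; `h3` moves
  -- it back to `A`.
  have h2 := h.toReal_mutualInformation_sub_le B A
  have h3 := h.abs_informationDerivative_sub_le A B (B - A)
  have h4 := Real.sqrt_le_sqrt (h.integral_norm_sub_error_sq_le A B)
  have h5 : h.informationDerivative B (A - B) = -h.informationDerivative B (B - A) := by
    rw [← map_neg, neg_sub]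
  have h6 := mul_le_mul_of_nonneg_right (mul_le_mul_of_nonneg_right h4 (Real.sqrt_nonneg C))
    (norm_nonneg (B - A))
  have h7 : 0 ≤ √(4 * ‖B - A‖ ^ 2 * S + (4 * ‖B - A‖ ^ 2 + 2 * ‖A‖ ^ 2) * D B) * √C * ‖B - A‖ := by
    positivity
  rw [h5, norm_sub_rev A B] at h2
  rw [abs_le] at h3
  have h8 : r B * ‖B - A‖ = ‖B - A‖ ^ 2 * C / 2 +
    √(4 * ‖B - A‖ ^ 2 * S + (4 * ‖B - A‖ ^ 2 + 2 * ‖A‖ ^ 2) * D B) * √C * ‖B - A‖ := by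
    rw [hr]
    ring
  rw [h8, Real.norm_eq_abs, abs_le]
  constructor <;> linarith [h3.1, h3.2]

/-- Orthogonality: the derivative only sees the estimation error of the input. -/
lemma informationDerivative_eq (h : IsGaussianChannel μ X N) (A H : E →L[ℝ] F) :
    h.informationDerivative A H = ∫ ω, ⟪A (X ω - bayesEstimate μ X N A ω),
      H (X ω - bayesEstimate μ X N A ω)⟫ ∂μ := by
  have hHe : MemLp (fun ω => H (bayesEstimate μ X N A ω)) 2 μ :=
    H.comp_memLp' (h.memLp_bayesEstimate A)
  have h0 : ∫ ω, ⟪A (X ω - bayesEstimate μ X N A ω), H (bayesEstimate μ X N A ω)⟫ ∂μ = 0 := by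
    rw [← integral_inner_sub_condExp (h.measurable_output A).comap_le h.memLp_input A H]
    refine integral_congr_ae ?_
    filter_upwards [h.bayesEstimate_ae_eq_condExp A] with ω hω
    rw [hω]
  rw [informationDerivative_apply]
  have h1 := integral_sub (h.integrable_inner_error_input A A H)
    ((h.memLp_clm_error A A).integrable_real_inner hHe)
  rw [h0, sub_zero] at h1
  rw [← h1]
  simp only [map_sub H, inner_sub_right]

end IsGaussianChannel

end Gradient

/-! ### The quadratic matrix loss and its convexity cone. -/

section Loss

variable {m n : ℕ}

lemma gaussianLoss_apply (Φ : Matrix (Fin m) (Fin n) ℝ) (x : EuclideanSpace ℝ (Fin n))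
    (i : Fin m) (j : Fin n) : gaussianLoss Φ x i j = (Φ *ᵥ x.ofLp) i * x j := by
  simp [gaussianLoss, outerSquare, Matrix.mul_apply, Matrix.vecMulVec_apply, Matrix.mulVec,
    dotProduct, Finset.sum_mul, mul_assoc]

/-- The linear map between Euclidean spaces defined by a matrix. -/
noncomputable def matrixCLM :
    Matrix (Fin m) (Fin n) ℝ →L[ℝ] EuclideanSpace ℝ (Fin n) →L[ℝ] EuclideanSpace ℝ (Fin m) :=
  LinearMap.toContinuousLinearMap
    (LinearMap.toContinuousLinearMap.toLinearMap ∘ₗ Matrix.toEuclideanLin.toLinearMap)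

lemma matrixCLM_apply (Φ : Matrix (Fin m) (Fin n) ℝ) (x : EuclideanSpace ℝ (Fin n)) :
    matrixCLM Φ x = WithLp.toLp 2 (Φ *ᵥ x.ofLp) := rfl

/-- The Fréchet derivative of `gaussianLoss Φ`. -/
noncomputable def gaussianLossDeriv (Φ : Matrix (Fin m) (Fin n) ℝ)
    (x : EuclideanSpace ℝ (Fin n)) :
    EuclideanSpace ℝ (Fin n) →L[ℝ] Matrix (Fin m) (Fin n) ℝ :=
  ContinuousLinearMap.pi fun i => ContinuousLinearMap.pi fun j =>
    (matrixCLM Φ x i) • EuclideanSpace.proj (𝕜 := ℝ) j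
      + x j • (EuclideanSpace.proj (𝕜 := ℝ) i ∘L matrixCLM Φ)

lemma gaussianLossDeriv_apply (Φ : Matrix (Fin m) (Fin n) ℝ) (x y : EuclideanSpace ℝ (Fin n))
    (i : Fin m) (j : Fin n) :
    gaussianLossDeriv Φ x y i j = (Φ *ᵥ x.ofLp) i * y j + x j * (Φ *ᵥ y.ofLp) i := rfl

lemma hasFDerivAt_gaussianLoss (Φ : Matrix (Fin m) (Fin n) ℝ) (x : EuclideanSpace ℝ (Fin n)) :
    HasFDerivAt (gaussianLoss Φ) (gaussianLossDeriv Φ x) x := by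
  have h : HasFDerivAt (fun (y : EuclideanSpace ℝ (Fin n)) (i : Fin m) (j : Fin n) =>
      (Φ *ᵥ y.ofLp) i * y j) (ContinuousLinearMap.pi fun i => ContinuousLinearMap.pi fun j =>
    (matrixCLM Φ x i) • EuclideanSpace.proj (𝕜 := ℝ) j
      + x j • (EuclideanSpace.proj (𝕜 := ℝ) i ∘L matrixCLM Φ)) x := by
    refine hasFDerivAt_pi.2 fun i => hasFDerivAt_pi.2 fun j => ?_
    exact (EuclideanSpace.proj (𝕜 := ℝ) i ∘L matrixCLM Φ).hasFDerivAt.mul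
      (EuclideanSpace.proj (𝕜 := ℝ) j).hasFDerivAt
  have hL : gaussianLoss Φ = fun (y : EuclideanSpace ℝ (Fin n)) (i : Fin m) (j : Fin n) =>
      (Φ *ᵥ y.ofLp) i * y j := by
    ext y i j
    exact gaussianLoss_apply Φ y i j
  rw [hL]
  exact h

lemma differentiable_gaussianLoss (Φ : Matrix (Fin m) (Fin n) ℝ) :
    Differentiable ℝ (gaussianLoss Φ) :=
  fun x => ⟨_, hasFDerivAt_gaussianLoss Φ x⟩

/-- The loss is homogeneous quadratic, so its first-order Taylor remainder is the loss of the
increment. -/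
lemma generalizedBregman_gaussianLoss (Φ : Matrix (Fin m) (Fin n) ℝ)
    (x y : EuclideanSpace ℝ (Fin n)) :
    generalizedBregman (gaussianLoss Φ) x y = gaussianLoss Φ (x - y) := by
  rw [generalizedBregman, (hasFDerivAt_gaussianLoss Φ y).fderiv]
  ext i j
  simp only [Matrix.sub_apply, gaussianLoss_apply, gaussianLossDeriv_apply, WithLp.ofLp_sub,
    Matrix.mulVec_sub, Pi.sub_apply]
  ring

lemma gaussianLoss_smul (Φ : Matrix (Fin m) (Fin n) ℝ) (x y : EuclideanSpace ℝ (Fin n)) (θ : ℝ) :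
    (θ • gaussianLoss Φ x + (1 - θ) • gaussianLoss Φ y) - gaussianLoss Φ (θ • x + (1 - θ) • y)
      = (θ * (1 - θ)) • gaussianLoss Φ (x - y) := by
  ext i j
  simp only [gaussianLoss_apply, Matrix.sub_apply, Matrix.add_apply, Matrix.smul_apply,
    WithLp.ofLp_add, WithLp.ofLp_smul, WithLp.ofLp_sub, Matrix.mulVec_add, Matrix.mulVec_smul,
    Matrix.mulVec_sub, Pi.add_apply, Pi.smul_apply, Pi.sub_apply, smul_eq_mul]
  ring

/-- The Frobenius pairing links matrix gradients to inner products in the output space. With `Ψ = Φ`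
it gives ‖Φx‖², which drives the cone argument. -/
lemma sum_mul_gaussianLoss (Φ Ψ : Matrix (Fin m) (Fin n) ℝ) (x : EuclideanSpace ℝ (Fin n)) :
    ∑ i, ∑ j, gaussianLoss Φ x i j * Ψ i j = inner ℝ (matrixCLM Φ x) (matrixCLM Ψ x) := by
  simp only [gaussianLoss_apply, matrixCLM_apply, PiLp.inner_apply, RCLike.inner_apply,
    conj_trivial]
  refine Finset.sum_congr rfl fun i _ => ?_
  rw [show (Ψ *ᵥ x.ofLp) i = ∑ j, Ψ i j * x j from rfl, Finset.sum_mul]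
  exact Finset.sum_congr rfl fun j _ => by ring

section Cone

attribute [local instance] Matrix.normedAddCommGroup Matrix.normedSpace

lemma norm_gaussianLoss_le (Φ : Matrix (Fin m) (Fin n) ℝ) (x : EuclideanSpace ℝ (Fin n)) :
    ‖gaussianLoss Φ x‖ ≤ ‖matrixCLM Φ x‖ * ‖x‖ := by
  rw [Matrix.norm_le_iff (by positivity)]
  intro i j
  rw [gaussianLoss_apply, norm_mul]
  exact mul_le_mul (PiLp.norm_apply_le (matrixCLM Φ x) i) (PiLp.norm_apply_le x j)
    (norm_nonneg _) (norm_nonneg _)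

/-- The cone of the matrices that make a small angle with `Φ`. -/
def angularCone (Φ : Matrix (Fin m) (Fin n) ℝ) (c : ℝ) : Set (Matrix (Fin m) (Fin n) ℝ) :=
  {M | c * ‖M‖ ≤ ∑ i, ∑ j, M i j * Φ i j}

lemma mem_interior_angularCone {Φ M : Matrix (Fin m) (Fin n) ℝ} {c : ℝ}
    (h : c * ‖M‖ < ∑ i, ∑ j, M i j * Φ i j) : M ∈ interior (angularCone Φ c) := by
  have ho : IsOpen {M : Matrix (Fin m) (Fin n) ℝ | c * ‖M‖ < ∑ i, ∑ j, M i j * Φ i j} :=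
    isOpen_lt (by fun_prop) (by fun_prop)
  have hs : {M : Matrix (Fin m) (Fin n) ℝ | c * ‖M‖ < ∑ i, ∑ j, M i j * Φ i j}
      ⊆ angularCone Φ c := by
    intro M hM
    simp only [Set.mem_ofPred_eq, angularCone] at hM ⊢
    exact hM.le
  exact interior_maximal hs ho h

lemma isProperMatrixCone_angularCone {Φ : Matrix (Fin m) (Fin n) ℝ} {c : ℝ} (hc : 0 < c)
    (hne : (interior (angularCone Φ c)).Nonempty) : IsProperMatrixCone (angularCone Φ c) where
  smul_mem a ha A hA := by
    simp only [angularCone, Set.mem_ofPred_eq] at hA ⊢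
    simp only [norm_smul, Real.norm_of_nonneg ha, Matrix.smul_apply, smul_eq_mul, mul_assoc,
      ← Finset.mul_sum]
    nlinarith
  convex A hA B hB a b ha hb hab := by
    simp only [angularCone, Set.mem_ofPred_eq] at hA hB ⊢
    have h1 : ‖a • A + b • B‖ ≤ a * ‖A‖ + b * ‖B‖ := by
      refine (norm_add_le _ _).trans ?_
      rw [norm_smul, norm_smul, Real.norm_of_nonneg ha, Real.norm_of_nonneg hb]
    have h2 : ∑ i, ∑ j, (a • A + b • B) i j * Φ i j
        = a * ∑ i, ∑ j, A i j * Φ i j + b * ∑ i, ∑ j, B i j * Φ i j := by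
      simp only [Matrix.add_apply, Matrix.smul_apply, smul_eq_mul, add_mul, mul_assoc,
        Finset.sum_add_distrib, ← Finset.mul_sum]
    rw [h2]
    nlinarith [mul_le_mul_of_nonneg_left h1 hc.le, mul_le_mul_of_nonneg_left hA ha,
      mul_le_mul_of_nonneg_left hB hb]
  isClosed := isClosed_le (by fun_prop) (by fun_prop)
  interior_nonempty := hne
  pointed A hA hA' := by
    simp only [angularCone, Set.mem_ofPred_eq, norm_neg, Matrix.neg_apply, neg_mul,
      Finset.sum_neg_distrib] at hA hA'
    have h1 : ‖A‖ ≤ 0 := by nlinarith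
    exact norm_le_zero_iff.1 h1

/-- The convexity defect is θ(1 - θ) F(x - y). Injectivity gives ‖x‖ ≤ k‖Φx‖, hence ‖F(x)‖ ≤ ‖Φx‖‖x‖
≤ k⟨F(x), Φ⟩. -/
lemma exists_cone_isStrictlyKConvexOn_gaussianLoss {Φ : Matrix (Fin m) (Fin n) ℝ}
    (hΦ : Function.Injective Φ.mulVec) :
    ∃ K : Set (Matrix (Fin m) (Fin n) ℝ), IsProperMatrixCone K ∧
      IsStrictlyKConvexOn K Set.univ (gaussianLoss Φ) := by
  have hinj : Function.Injective (matrixCLM Φ) := fun x y hxy =>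
    WithLp.ofLp_injective 2 (hΦ (WithLp.toLp_injective 2 hxy))
  obtain ⟨k, hk, hanti⟩ :=
    (matrixCLM Φ).toLinearMap.exists_antilipschitzWith (LinearMap.ker_eq_bot.2 hinj)
  have hlow : ∀ x, ‖x‖ ≤ k * ‖matrixCLM Φ x‖ := fun x => by
    simpa using hanti.le_mul_norm_sub x 0
  have hk' : (0 : ℝ) < k := hk
  -- The aperture 1/(2k), half of the admissible 1/k, makes the cone inequality strict.
  have hlt : ∀ x, x ≠ 0 → ∀ a : ℝ, 0 < a →
      a • gaussianLoss Φ x ∈ interior (angularCone Φ (1 / (2 * k))) := by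
    intro x hx a ha
    apply mem_interior_angularCone
    have h1 : ∑ i, ∑ j, (a • gaussianLoss Φ x) i j * Φ i j = a * ‖matrixCLM Φ x‖ ^ 2 := by
      simp only [Matrix.smul_apply, smul_eq_mul, mul_assoc, ← Finset.mul_sum,
        sum_mul_gaussianLoss, real_inner_self_eq_norm_sq]
    have hx0 : 0 < ‖x‖ := norm_pos_iff.2 hx
    have h2 := hlow x
    have h3 : 0 < ‖matrixCLM Φ x‖ := pos_of_mul_pos_right (hx0.trans_le h2) hk'.le
    have h4 := norm_gaussianLoss_le Φ x
    rw [h1, norm_smul, Real.norm_of_nonneg ha.le, div_mul_eq_mul_div, one_mul,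
      div_lt_iff₀ (by positivity), mul_assoc]
    refine mul_lt_mul_of_pos_left ?_ ha
    have h5 := mul_le_mul_of_nonneg_left h2 h3.le
    have h6 : 0 < k * ‖matrixCLM Φ x‖ ^ 2 := by positivity
    nlinarith
  refine ⟨angularCone Φ (1 / (2 * k)), isProperMatrixCone_angularCone (by positivity) ?_, ?_⟩
  -- A nonzero `x` supplies an interior point; for `n = 0` the matrix space is a single point and
  -- the cone is everything.
  · rcases subsingleton_or_nontrivial (EuclideanSpace ℝ (Fin n)) with hn | hn
    · have hn0 : IsEmpty (Fin n) := by
        by_contra hne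
        rw [not_isEmpty_iff] at hne
        obtain ⟨j⟩ := hne
        have := congrArg (fun v : EuclideanSpace ℝ (Fin n) => v j)
          (Subsingleton.elim (EuclideanSpace.single j 1) 0)
        simp at this
      have huniv : angularCone Φ (1 / (2 * k)) = Set.univ := by
        ext M
        have hM : M = 0 := Subsingleton.elim _ _
        simp [hM, angularCone]
      rw [huniv, interior_univ]
      exact Set.univ_nonempty
    · obtain ⟨x, hx⟩ := exists_ne (0 : EuclideanSpace ℝ (Fin n))
      exact ⟨_, hlt x hx 1 one_pos⟩
  · intro x _ y _ hxy θ h0 h1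
    rw [gaussianLoss_smul]
    exact hlt _ (sub_ne_zero.2 hxy) _ (mul_pos h0 (sub_pos.2 h1))

end Cone

end Loss

/-! ### Passage from linear maps to matrices, and the theorem. -/

section VectorChannel

variable {m n : ℕ} {Ω : Type*} [MeasurableSpace Ω] {μ : Measure Ω}

lemma HasFDerivAt.comp_matrixCLM
    {f : (EuclideanSpace ℝ (Fin n) →L[ℝ] EuclideanSpace ℝ (Fin m)) → ℝ}
    {Φ : Matrix (Fin m) (Fin n) ℝ}
    {L : (EuclideanSpace ℝ (Fin n) →L[ℝ] EuclideanSpace ℝ (Fin m)) →L[ℝ] ℝ}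
    (h : HasFDerivAt f L (matrixCLM Φ)) :
    HasFDerivAt (fun Ψ : Matrix (Fin m) (Fin n) ℝ => f (matrixCLM Ψ)) (L ∘L matrixCLM) Φ := by
  -- Viewing a matrix as a function of two indices places the chain rule on a normed space with the
  -- same topology.
  let T : (Fin m → Fin n → ℝ) →L[ℝ] EuclideanSpace ℝ (Fin n) →L[ℝ] EuclideanSpace ℝ (Fin m) :=
    matrixCLM
  exact HasFDerivAt.comp (f := T) (g := f) (x := (Φ : Fin m → Fin n → ℝ)) h T.hasFDerivAt

lemma matrixIntegrable_outerSquare {e : Ω → EuclideanSpace ℝ (Fin n)} (he : MemLp e 2 μ) :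
    MatrixIntegrable (fun ω => outerSquare (e ω)) μ := by
  intro i j
  exact MemLp.integrable_mul ((EuclideanSpace.proj (𝕜 := ℝ) i).comp_memLp' he)
    ((EuclideanSpace.proj (𝕜 := ℝ) j).comp_memLp' he)

lemma MatrixIntegrable.const_mul {l : ℕ} {M : Ω → Matrix (Fin m) (Fin n) ℝ}
    (hM : MatrixIntegrable M μ) (Φ : Matrix (Fin l) (Fin m) ℝ) :
    MatrixIntegrable (fun ω => Φ * M ω) μ := by
  intro i j
  simp only [Matrix.mul_apply]
  exact integrable_finsetSum _ fun k _ => (hM k j).const_mul _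

lemma matrixExpectation_const_mul {l : ℕ} {M : Ω → Matrix (Fin m) (Fin n) ℝ}
    (hM : MatrixIntegrable M μ) (Φ : Matrix (Fin l) (Fin m) ℝ) :
    matrixExpectation (fun ω => Φ * M ω) μ = Φ * matrixExpectation M μ := by
  ext i j
  simp only [matrixExpectation, Matrix.of_apply, Matrix.mul_apply]
  rw [integral_finsetSum _ fun k _ => (hM k j).const_mul _]
  simp only [integral_const_mul]

/-- The pairing of the averaged loss with a matrix. -/
lemma sum_matrixExpectation_gaussianLoss_mul {e : Ω → EuclideanSpace ℝ (Fin n)}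
    (he : MemLp e 2 μ) (Φ H : Matrix (Fin m) (Fin n) ℝ) :
    ∑ i, ∑ j, matrixExpectation (fun ω => gaussianLoss Φ (e ω)) μ i j * H i j
      = ∫ ω, inner ℝ (matrixCLM Φ (e ω)) (matrixCLM H (e ω)) ∂μ := by
  have hi : ∀ i j, Integrable (fun ω => gaussianLoss Φ (e ω) i j * H i j) μ := fun i j =>
    ((matrixIntegrable_outerSquare he).const_mul Φ i j).mul_const _
  simp only [← sum_mul_gaussianLoss, matrixExpectation, Matrix.of_apply]
  rw [integral_finsetSum _ fun i _ => integrable_finsetSum _ fun j _ => hi i j]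
  refine Finset.sum_congr rfl fun i _ => ?_
  rw [integral_finsetSum _ fun j _ => hi i j]
  exact Finset.sum_congr rfl fun j _ => (integral_mul_const _ _).symm

end VectorChannel

theorem mainTheorem3 {Ω : Type*} [MeasurableSpace Ω] (μ : Measure Ω) [IsProbabilityMeasure μ]
    (m n : ℕ) (X : Ω → EuclideanSpace ℝ (Fin n)) (N : Ω → EuclideanSpace ℝ (Fin m))
    (hX : Measurable X) (hN : Measurable N) (hX2 : MemLp X 2 μ)
    (hNlaw : μ.map N = stdGaussian (EuclideanSpace ℝ (Fin m)))
    (hXN : IndepFun X N μ) :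
    -- the mutual information is finite for every channel matrix
    (∀ Φ : Matrix (Fin m) (Fin n) ℝ, mutualInformation μ X (channelOutput Φ X N) ≠ ∞) ∧
    ∀ Φ : Matrix (Fin m) (Fin n) ℝ,
      -- `F` is Fréchet differentiable, and strictly convex for a proper cone if `Φ` has full
      -- column rank
      Differentiable ℝ (gaussianLoss Φ) ∧
      (Function.Injective Φ.mulVec →
        ∃ K : Set (Matrix (Fin m) (Fin n) ℝ), IsProperMatrixCone K ∧
          IsStrictlyKConvexOn K Set.univ (gaussianLoss Φ)) ∧
      -- the averaged divergence exists and is the gradient of the mutual information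
      MatrixIntegrable (fun ω => generalizedBregman (gaussianLoss Φ) (X ω)
        (conditionalMean μ X (channelOutput Φ X N) ω)) μ ∧
      HasMatrixGradientAt
        (fun Ψ => (mutualInformation μ X (channelOutput Ψ X N)).toReal)
        (matrixExpectation (fun ω => generalizedBregman (gaussianLoss Φ) (X ω)
          (conditionalMean μ X (channelOutput Φ X N) ω)) μ) Φ ∧
      -- the averaged divergence is `Φ` times the MMSE matrix
      MatrixIntegrable (fun ω => outerSquare
        (X ω - conditionalMean μ X (channelOutput Φ X N) ω)) μ ∧
      (matrixExpectation (fun ω => generalizedBregman (gaussianLoss Φ) (X ω)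
          (conditionalMean μ X (channelOutput Φ X N) ω)) μ) =
        Φ * mmseMatrix μ X (channelOutput Φ X N) := by
  have h : IsGaussianChannel μ X N := ⟨hX, hN, hX2, hNlaw, hXN⟩
  refine ⟨fun Φ => h.mutualInformation_ne_top (matrixCLM Φ), fun Φ => ?_⟩
  have hbayes : bayesEstimate μ X N (matrixCLM Φ)
      =ᵐ[μ] conditionalMean μ X (channelOutput Φ X N) := h.bayesEstimate_ae_eq_condExp _
  have herr : MemLp (fun ω => X ω - conditionalMean μ X (channelOutput Φ X N) ω) 2 μ :=
    hX2.sub (hX2.condExp (by norm_num))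
  have hint := matrixIntegrable_outerSquare herr
  simp only [generalizedBregman_gaussianLoss]
  refine ⟨differentiable_gaussianLoss Φ, exists_cone_isStrictlyKConvexOn_gaussianLoss,
    hint.const_mul Φ, ⟨_, fun H => ?_,
      (h.hasFDerivAt_mutualInformation (matrixCLM Φ)).comp_matrixCLM⟩,
    hint, matrixExpectation_const_mul hint Φ⟩
  -- Both sides become E⟪Φe, He⟫, on the right by orthogonality; the two versions of the conditional
  -- mean agree almost everywhere.
  rw [sum_matrixExpectation_gaussianLoss_mul herr, ContinuousLinearMap.comp_apply,
    h.informationDerivative_eq]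
  refine integral_congr_ae ?_
  filter_upwards [hbayes] with ω hω
  rw [hω]
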